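/- For every $\varepsilon>0$ there is a function $q:\mathbb{N}\to\mathbb{N}$ with $q(n)=\tilde O(\log n)$, i.e. $q(n)=O\big(\log n\cdot(\log\log n)^{k}\big)$ as $n\to\infty$ for some constant $k$ (here $q$, $k$ and the implied constant depend only on $\varepsilon$), such that for every Abelian group $G$ and every $n$, the space $\mathcal{P}_1$ of polynomials of degree at most $1$ from $\{0,1\}^n$ to $G$, that is, of all functions $P(x)=\alpha_0+\sum_{i=1}^n x_i\alpha_i$ with $\alpha_0,\dots,\alpha_n\in G$, has a $\left(\tfrac14-\varepsilon,\,q(n)\right)$-local correction algorithm. Here a $(\delta,q)$-local correction algorithm for a set $\mathcal{F}$ of functions $\{0,1\}^n\to G$ is a probabilistic (possibly adaptive) oracle algorithm that makes at most $q$ queries to its oracle and that, for every $f:\{0,1\}^n\to G$ and every $P\in\mathcal{F}$ with $\Pr_{x\sim\{0,1\}^n}[f(x)\neq P(x)]\le\delta$, given oracle access to $f$ and any input $\mathbf{a}\in\{0,1\}^n$, returns $P(\mathbf{a})$ with probability at least $3/4$. -/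

import Mathlib

open Filter Asymptotics

/-- The Boolean cube `{0,1}^n`. -/
abbrev Cube (n : ℕ) : Type := Fin n → Bool

/-- The fractional Hamming distance `δ(f, g)`: the fraction of points of the cube at which
`f` and `g` disagree. -/
noncomputable def relDist {n : ℕ} {G : Type*} (f g : Cube n → G) : ℝ :=
  open Classical in (hammingDist f g : ℝ) / 2 ^ n

/-- The space `𝒫_d` of functions `{0,1}^n → G` given by multilinear polynomials of degree at most
`d` with coefficients in the Abelian group `G`: `x ↦ ∑_{|I| ≤ d} (∏_{i ∈ I} x_i) • α_I`. -/
def polyDegLE (n : ℕ) (G : Type*) [AddCommGroup G] (d : ℕ) : Set (Cube n → G) :=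
  {P | ∃ α : Finset (Fin n) → G, ∀ x : Cube n,
    P x = ∑ I : Finset (Fin n) with I.card ≤ d, (∏ i ∈ I, (x i).toNat) • α I}

/-- A deterministic algorithm with access to an oracle `X → G` and output in `O`, as an adaptive
query tree: it either stops with an output, or queries the oracle at a point and continues
depending on the answer. -/
inductive QueryTree (X G O : Type*) : Type _ where
  | ret (o : O) : QueryTree X G O
  | query (x : X) (next : G → QueryTree X G O) : QueryTree X G O

namespace QueryTree

/-- The output on oracle `f`. -/
def run {X G O : Type*} (f : X → G) : QueryTree X G O → O
  | ret o => o
  | query x next => run f (next (f x))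

/-- The number of oracle queries made on oracle `f` (repeated queries are counted). -/
def numQueries {X G O : Type*} (f : X → G) : QueryTree X G O → ℕ
  | ret _ => 0
  | query x next => numQueries f (next (f x)) + 1

end QueryTree

/-- A probabilistic algorithm with inputs in `I`, access to an oracle `X → G` and output in `O`:
it draws a uniformly random seed from a nonempty finite set, and then runs an adaptive query tree
determined by the seed and the input. -/
structure ProbOracleAlg (I X G O : Type*) where
  Seed : Type
  [seedFintype : Fintype Seed]
  [seedNonempty : Nonempty Seed]
  tree : Seed → I → QueryTree X G O

namespace ProbOracleAlg

attribute [instance] seedFintype seedNonempty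

/-- The algorithm makes at most `q` queries, for every input, oracle and seed. -/
def MakesAtMost {I X G O : Type*} (A : ProbOracleAlg I X G O) (q : ℕ) : Prop :=
  ∀ (f : X → G) (a : I) (r : A.Seed), (A.tree r a).numQueries f ≤ q

/-- The probability, over the seed, that the output on input `a` with oracle `f` is `o`. -/
noncomputable def probOutput {I X G O : Type*} (A : ProbOracleAlg I X G O)
    (f : X → G) (a : I) (o : O) : ℝ :=
  open Classical in
  ((Finset.univ.filter fun r : A.Seed => (A.tree r a).run f = o).card : ℝ) / Fintype.card A.Seed

end ProbOracleAlg

/-- `ℱ` has a `(δ, q)`-local correction algorithm: there is a probabilistic algorithm making at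
most `q` oracle queries that, for every `f` that is `δ`-close to some `P ∈ ℱ` and every input
`a ∈ {0,1}^n`, given oracle access to `f`, outputs `P(a)` with probability at least `3/4`. -/
def HasLocalCorrection {n : ℕ} {G : Type*} (ℱ : Set (Cube n → G)) (δ : ℝ) (q : ℕ) : Prop :=
  ∃ A : ProbOracleAlg (Cube n) (Cube n) G G, A.MakesAtMost q ∧
    ∀ f : Cube n → G, ∀ P ∈ ℱ, relDist f P ≤ δ →
      ∀ a : Cube n, 3 / 4 ≤ A.probOutput f a (P a)

/-- `g(n) = Õ(h(n))` as `n → ∞`: `g = O(h · (log h)^k)` for some constant `k`. -/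
def IsSoftO (g h : ℕ → ℝ) : Prop :=
  ∃ k : ℕ, g =O[atTop] fun n => h n * Real.log (h n) ^ k

/-! Values of an affine P are recovered from integer relations among points of the cube: if integers
c_j sum to 1 and ∑ c_j y_j = x coordinatewise, then ∑ c_j P(y_j) = P(x) in every abelian group.
Three correctors are composed.

(1) From error 1/4 - ε to a constant. Through a random x passes a random k-dimensional subcube,
obtained by tying the coordinates together in k random blocks. By Fourier analysis the error
fraction on it has variance at most 1/k (`expect_subcubeMean_sub_sq_le`), so it usually stays below
1/4. The restriction of P is then the only affine function that close, since distinct affine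
functions differ on at least half of a cube. This costs 2^k queries, with k depending on ε only.

(2) From a constant to O(1/log n). The relation P(x) = P(y) + P(z) - P(w) gives three estimates,
independent given x, and a wrong majority needs errors at two points of correlation at most 1/4.
Small-set expansion (`expect_mul_le_of_correlation`) bounds this by the 3/2 power of the error, so
nine queries turn σ^4 into σ^5 (`hasReduction_swap`). The error decays doubly exponentially in the
number of rounds, so about log log log n rounds suffice, at the cost of a power of log log n.

(3) From O(1/log n) to an arbitrary point. In each coordinate two random m-bit numbers are added,
where 2^m ≥ n. The summand bits, the sum bits and the final carry satisfy an integer relation whose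
coefficients sum to 1 and whose value is 0. Each of the 3m + 1 query points has density at most 3,
so a union bound finishes (`hasCorrection_adder`). -/

open scoped BigOperators

/-! ### Uniform probability on a finite type -/

/-- The real-valued indicator of a proposition. -/
noncomputable def ind (p : Prop) : ℝ :=
  open Classical in if p then 1 else 0

theorem ind_of {p : Prop} (h : p) : ind p = 1 := if_pos h

theorem ind_of_not {p : Prop} (h : ¬p) : ind p = 0 := if_neg h

theorem ind_nonneg (p : Prop) : 0 ≤ ind p := by
  unfold ind; split_ifs <;> norm_num

theorem ind_le_one (p : Prop) : ind p ≤ 1 := by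
  unfold ind; split_ifs <;> norm_num

theorem ind_mono {p q : Prop} (h : p → q) : ind p ≤ ind q := by
  by_cases hp : p
  · rw [ind_of hp, ind_of (h hp)]
  · rw [ind_of_not hp]; exact ind_nonneg q

theorem ind_or_le (p q : Prop) : ind (p ∨ q) ≤ ind p + ind q := by
  by_cases hp : p
  · rw [ind_of (Or.inl hp), ind_of hp]; linarith [ind_nonneg q]
  · rw [ind_of_not hp, zero_add]; exact ind_mono fun h => h.resolve_left hp

theorem ind_and (p q : Prop) : ind (p ∧ q) = ind p * ind q := by
  by_cases hp : p <;> by_cases hq : q <;> simp [ind, hp, hq]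

theorem ind_not (p : Prop) : ind (¬p) = 1 - ind p := by
  by_cases hp : p <;> simp [ind, hp]

theorem ind_exists_le {ι : Type*} [Fintype ι] (p : ι → Prop) : ind (∃ i, p i) ≤ ∑ i, ind (p i) := by
  by_cases h : ∃ i, p i
  · obtain ⟨i, hi⟩ := h
    rw [ind_of ⟨i, hi⟩, ← ind_of hi]
    exact Finset.single_le_sum (f := fun i => ind (p i)) (fun j _ => ind_nonneg _)
      (Finset.mem_univ i)
  · rw [ind_of_not h]
    exact Finset.sum_nonneg fun j _ => ind_nonneg _

/-- The probability of an event under the uniform distribution on a finite type. -/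
noncomputable def prob {Ω : Type*} [Fintype Ω] (p : Ω → Prop) : ℝ := 𝔼 ω, ind (p ω)

section prob

variable {Ω Ω' : Type*} [Fintype Ω] [Fintype Ω']

theorem expect_mono {f g : Ω → ℝ} (h : ∀ ω, f ω ≤ g ω) : 𝔼 ω, f ω ≤ 𝔼 ω, g ω :=
  Finset.expect_le_expect fun ω _ => h ω

theorem expect_prod (f : Ω × Ω' → ℝ) : 𝔼 ω, f ω = 𝔼 ω, 𝔼 ω', f (ω, ω') := by
  rw [← Finset.univ_product_univ, Finset.expect_product]

theorem prob_nonneg (p : Ω → Prop) : 0 ≤ prob p :=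
  Finset.expect_nonneg fun _ _ => ind_nonneg _

theorem prob_le_one [Nonempty Ω] (p : Ω → Prop) : prob p ≤ 1 :=
  Finset.expect_le Finset.univ_nonempty fun _ _ => ind_le_one _

theorem prob_mono {p q : Ω → Prop} (h : ∀ ω, p ω → q ω) : prob p ≤ prob q :=
  expect_mono fun ω => ind_mono (h ω)

theorem prob_or_le (p q : Ω → Prop) : prob (fun ω => p ω ∨ q ω) ≤ prob p + prob q := by
  unfold prob
  rw [← Finset.expect_add_distrib]
  exact expect_mono fun ω => ind_or_le _ _

theorem prob_exists_le {ι : Type*} [Fintype ι] (p : ι → Ω → Prop) :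
    prob (fun ω => ∃ i, p i ω) ≤ ∑ i, prob (p i) := by
  unfold prob
  rw [← Finset.expect_sum_comm]
  exact expect_mono fun ω => ind_exists_le _

theorem prob_not [Nonempty Ω] (p : Ω → Prop) : prob (fun ω => ¬p ω) = 1 - prob p := by
  unfold prob
  simp_rw [ind_not]
  rw [Finset.expect_sub_distrib, Fintype.expect_const]

theorem prob_eq_card_div (p : Ω → Prop) [DecidablePred p] :
    prob p = (Finset.univ.filter p).card / Fintype.card Ω := by
  unfold prob ind
  rw [Fintype.expect_eq_sum_div_card]
  simp only [Finset.card_filter, Nat.cast_sum, Nat.cast_ite, Nat.cast_one, Nat.cast_zero]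
  congr!

theorem prob_prod (p : Ω × Ω' → Prop) : prob p = 𝔼 ω, prob fun ω' => p (ω, ω') :=
  expect_prod _

theorem prob_equiv (e : Ω ≃ Ω') (p : Ω' → Prop) : prob (fun ω => p (e ω)) = prob p :=
  Fintype.expect_equiv e _ _ fun _ => rfl

/-- Markov's inequality. -/
theorem prob_lt_le_of_expect_le {f : Ω → ℝ} (hf : ∀ ω, 0 ≤ f ω) {c η : ℝ} (hc : 0 < c)
    (h : 𝔼 ω, f ω ≤ η * c) : prob (fun ω => c < f ω) ≤ η := by
  have h1 : prob (fun ω => c < f ω) * c ≤ 𝔼 ω, f ω := by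
    unfold prob
    rw [Finset.expect_mul]
    refine expect_mono fun ω => ?_
    by_cases hω : c < f ω
    · rw [ind_of hω, one_mul]; exact hω.le
    · rw [ind_of_not hω, zero_mul]; exact hf ω
  exact le_of_mul_le_mul_right (h1.trans h) hc

end prob

theorem relDist_eq_prob {n : ℕ} {G : Type*} (f g : Cube n → G) :
    relDist f g = prob fun x => f x ≠ g x := by
  classical
  rw [prob_eq_card_div]
  unfold relDist hammingDist
  simp only [Fintype.card_fun, Fintype.card_bool, Fintype.card_fin, Nat.cast_pow, Nat.cast_ofNat]

theorem ProbOracleAlg.probOutput_eq_prob {I X G O : Type*} (A : ProbOracleAlg I X G O)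
    (f : X → G) (a : I) (o : O) :
    A.probOutput f a o = prob fun r : A.Seed => (A.tree r a).run f = o := by
  classical
  rw [prob_eq_card_div]
  unfold ProbOracleAlg.probOutput
  congr!

/-! ### Query trees and composition of algorithms -/

namespace QueryTree

/-- Run a query tree, answering its queries by running other query trees. -/
def subst {X Y G H O : Type*} (s : X → QueryTree Y H G) : QueryTree X G O → QueryTree Y H O
  | ret o => ret o
  | query x next => bind (s x) fun g => subst s (next g)
where
  /-- Continue a query tree with a query tree depending on its output. -/
  bind : QueryTree Y H G → (G → QueryTree Y H O) → QueryTree Y H O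
    | ret g, k => k g
    | query y next, k => query y fun h => bind (next h) k

theorem run_bind {Y G H O : Type*} (f : Y → H) (t : QueryTree Y H G)
    (k : G → QueryTree Y H O) : run f (subst.bind t k) = run f (k (run f t)) := by
  induction t with
  | ret g => rfl
  | query y next ih => exact ih (f y)

theorem numQueries_bind {Y G H O : Type*} (f : Y → H) (t : QueryTree Y H G)
    (k : G → QueryTree Y H O) :
    numQueries f (subst.bind t k) = numQueries f t + numQueries f (k (run f t)) := by
  induction t with
  | ret g => simp [subst.bind, numQueries, run]
  | query y next ih =>
    simp only [subst.bind, numQueries, run, ih]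
    omega

theorem run_subst {X Y G H O : Type*} (f : Y → H) (s : X → QueryTree Y H G)
    (t : QueryTree X G O) : run f (subst s t) = run (fun x => run f (s x)) t := by
  induction t with
  | ret o => rfl
  | query x next ih => simp only [subst, run_bind, ih, run]

theorem numQueries_subst_le {X Y G H O : Type*} (f : Y → H) (s : X → QueryTree Y H G) {q : ℕ}
    (hs : ∀ x, numQueries f (s x) ≤ q) (t : QueryTree X G O) :
    numQueries f (subst s t) ≤ q * numQueries (fun x => run f (s x)) t := by
  induction t with
  | ret o => simp [subst, numQueries]
  | query x next ih =>
    simp only [subst, numQueries_bind, numQueries]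
    have := ih (run f (s x))
    have := hs x
    rw [mul_add, mul_one]
    omega

/-- Query the oracle at the points `y 0, …, y (m - 1)` and decode the answers. -/
def ofFin {X G O : Type*} : (m : ℕ) → (Fin m → X) → ((Fin m → G) → O) → QueryTree X G O
  | 0, _, d => ret (d Fin.elim0)
  | m + 1, y, d => query (y 0) fun g => ofFin m (Fin.tail y) fun v => d (Fin.cons g v)

theorem run_ofFin {X G O : Type*} (f : X → G) (m : ℕ) (y : Fin m → X) (d : (Fin m → G) → O) :
    run f (ofFin m y d) = d (f ∘ y) := by
  induction m with
  | zero => simp only [ofFin, run]; congr 1; exact Subsingleton.elim _ _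
  | succ m ih =>
    simp only [ofFin, run, ih]
    congr 1
    funext i
    refine Fin.cases ?_ (fun j => ?_) i <;> simp [Fin.tail]

theorem numQueries_ofFin {X G O : Type*} (f : X → G) (m : ℕ) (y : Fin m → X)
    (d : (Fin m → G) → O) : numQueries f (ofFin m y d) = m := by
  induction m with
  | zero => rfl
  | succ m ih => simp only [ofFin, numQueries, ih]

/-- Query the oracle at all points of a finite family and decode the answers. -/
noncomputable def nonadaptive {ι X G O : Type*} [Fintype ι] (y : ι → X) (d : (ι → G) → O) :
    QueryTree X G O :=
  ofFin (Fintype.card ι) (y ∘ (Fintype.equivFin ι).symm) fun v => d (v ∘ Fintype.equivFin ι)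

theorem run_nonadaptive {ι X G O : Type*} [Fintype ι] (f : X → G) (y : ι → X)
    (d : (ι → G) → O) : run f (nonadaptive y d) = d (f ∘ y) := by
  unfold nonadaptive
  rw [run_ofFin]
  congr 1
  funext i
  simp

theorem numQueries_nonadaptive {ι X G O : Type*} [Fintype ι] (f : X → G) (y : ι → X)
    (d : (ι → G) → O) : numQueries f (nonadaptive y d) = Fintype.card ι :=
  numQueries_ofFin ..

end QueryTree

namespace ProbOracleAlg

/-- Run the algorithm `B`, answering its queries by the algorithm `A` with one common seed. -/
def comp {I X Y G H O : Type*} (B : ProbOracleAlg I X G O) (A : ProbOracleAlg X Y H G) :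
    ProbOracleAlg I Y H O where
  Seed := A.Seed × B.Seed
  tree r a := (B.tree r.2 a).subst (A.tree r.1)

theorem MakesAtMost.comp {I X Y G H O : Type*} {B : ProbOracleAlg I X G O}
    {A : ProbOracleAlg X Y H G} {q q' : ℕ} (hB : B.MakesAtMost q') (hA : A.MakesAtMost q) :
    (B.comp A).MakesAtMost (q * q') := fun f a r =>
  (QueryTree.numQueries_subst_le f _ (fun x => hA f x r.1) _).trans
    (Nat.mul_le_mul_left q (hB _ a r.2))

theorem run_comp {I X Y G H O : Type*} (B : ProbOracleAlg I X G O) (A : ProbOracleAlg X Y H G)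
    (f : Y → H) (a : I) (r : A.Seed × B.Seed) :
    ((B.comp A).tree r a).run f = (B.tree r.2 a).run fun x => (A.tree r.1 x).run f :=
  QueryTree.run_subst ..

/-- The algorithm that, on seed `r` and input `a`, queries the oracle at all points `y r a i` and
decodes the answers by `d`. -/
noncomputable def nonadaptive {I X G O ι : Type*} [Fintype ι] (R : Type) [Fintype R] [Nonempty R]
    (y : R → I → ι → X) (d : (ι → G) → O) : ProbOracleAlg I X G O where
  Seed := R
  tree r a := QueryTree.nonadaptive (y r a) d

theorem nonadaptive_makesAtMost {I X G O ι : Type*} [Fintype ι] (R : Type) [Fintype R]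
    [Nonempty R] (y : R → I → ι → X) (d : (ι → G) → O) :
    (nonadaptive R y d).MakesAtMost (Fintype.card ι) := fun f a r =>
  (QueryTree.numQueries_nonadaptive f (y r a) d).le

theorem run_nonadaptive {I X G O ι : Type*} [Fintype ι] (R : Type) [Fintype R]
    [Nonempty R] (y : R → I → ι → X) (d : (ι → G) → O) (f : X → G) (a : I) (r : R) :
    ((nonadaptive R y d).tree r a).run f = d (f ∘ y r a) :=
  QueryTree.run_nonadaptive ..

/-- If the first stage fails with probability at most `η` and the second stage fails with
probability at most `η'` whenever the first one succeeds, then some stage fails with probability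
at most `η + η'`. -/
theorem prob_two_stage_le {R R' : Type*} [Fintype R] [Fintype R'] [Nonempty R] [Nonempty R']
    (good : R → Prop) (bad : R × R' → Prop) {η η' : ℝ} (h : prob (fun r => ¬good r) ≤ η)
    (hη' : 0 ≤ η')
    (h' : ∀ r, good r → prob (fun r' => bad (r, r')) ≤ η') : prob bad ≤ η + η' := by
  rw [prob_prod]
  calc 𝔼 r, prob (fun r' => bad (r, r')) ≤ 𝔼 r, (ind (¬good r) + η') := by
        refine expect_mono fun r => ?_
        by_cases hr : good r
        · linarith [h' r hr, ind_nonneg (¬good r)]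
        · rw [ind_of hr]; linarith [prob_le_one fun r' => bad (r, r')]
    _ ≤ η + η' := by
        rw [Finset.expect_add_distrib, Fintype.expect_const]
        exact add_le_add_left h _

end ProbOracleAlg

/-- There is an algorithm with at most `q` queries per evaluation which, except with probability
`η` over its seed, turns a function that is `δ`-close to some `P ∈ ℱ` into one that is `δ'`-close
to `P`. -/
def HasReduction {n : ℕ} {G : Type*} (ℱ : Set (Cube n → G)) (δ δ' η : ℝ) (q : ℕ) : Prop :=
  ∃ A : ProbOracleAlg (Cube n) (Cube n) G G, A.MakesAtMost q ∧
    ∀ f : Cube n → G, ∀ P ∈ ℱ, relDist f P ≤ δ →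
      prob (fun r : A.Seed => ¬relDist (fun x => (A.tree r x).run f) P ≤ δ') ≤ η

/-- `HasLocalCorrection` with failure probability `η`. -/
def HasCorrection {n : ℕ} {G : Type*} (ℱ : Set (Cube n → G)) (δ η : ℝ) (q : ℕ) : Prop :=
  ∃ A : ProbOracleAlg (Cube n) (Cube n) G G, A.MakesAtMost q ∧
    ∀ f : Cube n → G, ∀ P ∈ ℱ, relDist f P ≤ δ →
      ∀ a : Cube n, prob (fun r : A.Seed => (A.tree r a).run f ≠ P a) ≤ η

section composition

variable {n : ℕ} {G : Type*} {ℱ : Set (Cube n → G)} {δ δ' δ'' η η' : ℝ} {q q' : ℕ}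

/-- The seed of the inner algorithm is drawn once and shared by all its calls. Conditioned on a good
seed, the outer algorithm therefore faces one fixed oracle that is close to P. -/
theorem HasReduction.trans (hA : HasReduction ℱ δ δ' η q) (hB : HasReduction ℱ δ' δ'' η' q')
    (hη' : 0 ≤ η') : HasReduction ℱ δ δ'' (η + η') (q * q') := by
  obtain ⟨A, hAq, hA⟩ := hA
  obtain ⟨B, hBq, hB⟩ := hB
  refine ⟨B.comp A, hBq.comp hAq, fun f P hP hf => ?_⟩
  refine ProbOracleAlg.prob_two_stage_le (R := A.Seed) (R' := B.Seed) _ _ (hA f P hP hf) hη'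
    fun r hr => ?_
  simp_rw [ProbOracleAlg.run_comp]
  exact hB _ P hP hr

theorem HasReduction.hasCorrection (hA : HasReduction ℱ δ δ' η q)
    (hB : HasCorrection ℱ δ' η' q') (hη' : 0 ≤ η') : HasCorrection ℱ δ (η + η') (q * q') := by
  obtain ⟨A, hAq, hA⟩ := hA
  obtain ⟨B, hBq, hB⟩ := hB
  refine ⟨B.comp A, hBq.comp hAq, fun f P hP hf a => ?_⟩
  refine ProbOracleAlg.prob_two_stage_le (R := A.Seed) (R' := B.Seed) _ _ (hA f P hP hf) hη'
    fun r hr => ?_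
  simp_rw [ProbOracleAlg.run_comp]
  exact hB _ P hP hr a

theorem HasCorrection.hasLocalCorrection (h : HasCorrection ℱ δ η q) (hη : η ≤ 1 / 4) :
    HasLocalCorrection ℱ δ q := by
  obtain ⟨A, hAq, hA⟩ := h
  refine ⟨A, hAq, fun f P hP hf a => ?_⟩
  rw [ProbOracleAlg.probOutput_eq_prob]
  have := hA f P hP hf a
  rw [prob_not] at this
  linarith

theorem HasReduction.mono (h : HasReduction ℱ δ δ' η q) (hδ : δ'' ≤ δ) (hη : η ≤ η') :
    HasReduction ℱ δ'' δ' η' q := by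
  obtain ⟨A, hAq, hA⟩ := h
  exact ⟨A, hAq, fun f P hP hf => (hA f P hP (hf.trans hδ)).trans hη⟩

theorem HasReduction.refl (ℱ : Set (Cube n → G)) (δ : ℝ) : HasReduction ℱ δ δ 0 1 := by
  refine ⟨ProbOracleAlg.nonadaptive Unit (fun _ x (_ : Unit) => x) fun v => v (), ?_, ?_⟩
  · exact ProbOracleAlg.nonadaptive_makesAtMost Unit _ _
  · intro f P _ hf
    refine (Finset.expect_eq_zero fun r _ => ind_of_not (not_not.2 ?_)).le
    refine le_of_eq_of_le (congrArg (relDist · P) (funext fun x => ?_)) hf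
    exact ProbOracleAlg.run_nonadaptive Unit _ _ f x r

/-- A reduction from an algorithm whose error, averaged over inputs and seeds, is at most
`η * δ'`. -/
theorem hasReduction_of_expect_le {ι : Type*} [Fintype ι] (R : Type) [Fintype R] [Nonempty R]
    (y : R → Cube n → ι → Cube n) (d : (ι → G) → G) (hδ' : 0 < δ')
    (h : ∀ f : Cube n → G, ∀ P ∈ ℱ, relDist f P ≤ δ →
      prob (fun ω : R × Cube n => d (f ∘ y ω.1 ω.2) ≠ P ω.2) ≤ η * δ') :
    HasReduction ℱ δ δ' η (Fintype.card ι) := by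
  refine ⟨ProbOracleAlg.nonadaptive R y d, ProbOracleAlg.nonadaptive_makesAtMost R y d, ?_⟩
  intro f P hP hf
  change prob (fun r : R => ¬relDist
    (fun x => ((ProbOracleAlg.nonadaptive R y d).tree r x).run f) P ≤ δ') ≤ η
  simp_rw [ProbOracleAlg.run_nonadaptive R y d, relDist_eq_prob, not_le]
  refine prob_lt_le_of_expect_le (fun r => prob_nonneg _) hδ' ?_
  have := h f P hP hf
  rwa [prob_prod] at this

theorem hasCorrection_of_prob_le {ι : Type*} [Fintype ι] (R : Type) [Fintype R] [Nonempty R]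
    (y : R → Cube n → ι → Cube n) (d : (ι → G) → G)
    (h : ∀ f : Cube n → G, ∀ P ∈ ℱ, relDist f P ≤ δ → ∀ a,
      prob (fun r : R => d (f ∘ y r a) ≠ P a) ≤ η) :
    HasCorrection ℱ δ η (Fintype.card ι) := by
  refine ⟨ProbOracleAlg.nonadaptive R y d, ProbOracleAlg.nonadaptive_makesAtMost R y d, ?_⟩
  intro f P hP hf a
  change prob (fun r : R => ((ProbOracleAlg.nonadaptive R y d).tree r a).run f ≠ P a) ≤ η
  simp_rw [ProbOracleAlg.run_nonadaptive R y d]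
  exact h f P hP hf a

end composition

/-! ### Affine functions on the cube -/

/-- Functions `x ↦ α₀ + ∑ i, xᵢ • αᵢ` on the cube. -/
def IsAffine {n : ℕ} {G : Type*} [AddCommGroup G] (P : Cube n → G) : Prop :=
  ∃ (α₀ : G) (α : Fin n → G), ∀ x, P x = α₀ + ∑ i, (x i).toNat • α i

section affine

variable {n : ℕ} {G : Type*} [AddCommGroup G] {P Q : Cube n → G}

theorem isAffine_of_mem_polyDegLE (hP : P ∈ polyDegLE n G 1) : IsAffine P := by
  classical
  obtain ⟨α, hα⟩ := hP
  refine ⟨α ∅, fun i => α {i}, fun x => ?_⟩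
  have hfilter : (Finset.univ.filter fun I : Finset (Fin n) => I.card ≤ 1) =
      insert ∅ (Finset.univ.image fun i : Fin n => ({i} : Finset (Fin n))) := by
    ext I
    simp only [Finset.mem_filter, Finset.mem_univ, true_and, Finset.mem_insert, Finset.mem_image,
      Nat.le_one_iff_eq_zero_or_eq_one, Finset.card_eq_zero, Finset.card_eq_one, eq_comm (b := I)]
  rw [hα, hfilter, Finset.sum_insert, Finset.sum_image]
  · simp
  · intro i _ j _ h
    exact Finset.singleton_injective h
  · simp

/-- The coefficients are integers because G admits no division; both the swap estimate and the adder
rest on such a relation. -/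
theorem IsAffine.sum_zsmul (hP : IsAffine P) {ι : Type*} [Fintype ι] (c : ι → ℤ)
    (y : ι → Cube n) (x : Cube n) (hc : ∑ j, c j = 1)
    (h : ∀ i, ∑ j, c j * ((y j i).toNat : ℤ) = (x i).toNat) : ∑ j, c j • P (y j) = P x := by
  obtain ⟨α₀, α, hα⟩ := hP
  simp_rw [hα, smul_add, Finset.sum_add_distrib, ← Finset.sum_smul, hc, one_smul,
    Finset.smul_sum]
  congr 1
  rw [Finset.sum_comm]
  refine Finset.sum_congr rfl fun i _ => ?_
  simp_rw [← natCast_zsmul (α i), smul_smul, ← Finset.sum_smul, h]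

theorem toNat_xor (a b : Bool) :
    ((xor a b).toNat : ℤ) = a.toNat + (1 - 2 * (a.toNat : ℤ)) * b.toNat := by
  cases a <;> cases b <;> rfl

/-- For fixed x, x ⊕ b = x + (1 - 2x) b is affine in the bit b, and the coefficients of coordinates
in one block add up. -/
theorem IsAffine.comp_xor (hP : IsAffine P) {k : ℕ} (x : Cube n) (h : Fin n → Fin k) :
    IsAffine fun y : Cube k => P fun i => xor (x i) (y (h i)) := by
  obtain ⟨α₀, α, hα⟩ := hP
  refine ⟨P x, fun j => ∑ i with h i = j, (1 - 2 * ((x i).toNat : ℤ)) • α i, fun y => ?_⟩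
  have key : ∑ j, (y j).toNat • ∑ i with h i = j, (1 - 2 * ((x i).toNat : ℤ)) • α i =
      ∑ i, ((1 - 2 * ((x i).toNat : ℤ)) * (y (h i)).toNat) • α i := by
    rw [← Finset.sum_fiberwise Finset.univ h]
    refine Finset.sum_congr rfl fun j _ => ?_
    rw [Finset.smul_sum]
    refine Finset.sum_congr rfl fun i hi => ?_
    rw [(Finset.mem_filter.1 hi).2, ← natCast_zsmul, smul_smul, mul_comm]
  rw [key]
  beta_reduce
  rw [hα, hα, add_assoc, ← Finset.sum_add_distrib]
  congr 1
  refine Finset.sum_congr rfl fun i _ => ?_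
  rw [← natCast_zsmul, ← natCast_zsmul, toNat_xor, add_smul]

theorem IsAffine.sub (hP : IsAffine P) (hQ : IsAffine Q) : IsAffine fun x => P x - Q x := by
  obtain ⟨α₀, α, hα⟩ := hP
  obtain ⟨β₀, β, hβ⟩ := hQ
  refine ⟨α₀ - β₀, fun i => α i - β i, fun x => ?_⟩
  simp only [hα, hβ, smul_sub, Finset.sum_sub_distrib]
  abel

/-- Flipping one coordinate of a point of the cube. -/
def flipCoord (i : Fin n) : Equiv.Perm (Cube n) :=
  Function.Involutive.toPerm (fun x => Function.update x i (!x i)) fun x => by simp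

theorem flipCoord_apply (i : Fin n) (x : Cube n) :
    flipCoord i x = Function.update x i (!x i) := rfl

/-- An affine function that vanishes on more than half of the cube is zero. -/
theorem IsAffine.eq_zero_of_half_lt (hP : IsAffine P) (h : 1 / 2 < prob fun x => P x = 0)
    (x : Cube n) : P x = 0 := by
  obtain ⟨α₀, α, hα⟩ := hP
  have hzero : ∀ i, α i = 0 := by
    intro i
    by_contra hi
    have h1 : prob (fun x => P (flipCoord i x) = 0) = prob fun x => P x = 0 :=
      prob_equiv (flipCoord i) fun x => P x = 0
    -- If α i ≠ 0, a point and its flip at i cannot both be zeros, because the two values differ by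
    -- ± α i.
    have h2 : prob (fun x => P x = 0) + prob (fun x => P (flipCoord i x) = 0) ≤ 1 := by
      unfold prob
      rw [← Finset.expect_add_distrib]
      refine Finset.expect_le Finset.univ_nonempty fun x _ => ?_
      by_cases hx : P x = 0
      · rw [ind_of hx, ind_of_not, add_zero]
        intro hx'
        apply hi
        have e : P (flipCoord i x) - P x = 0 := by rw [hx, hx', sub_zero]
        rw [hα, hα, add_sub_add_left_eq_sub, ← Finset.sum_sub_distrib,
          Finset.sum_eq_single i] at e
        · cases hxi : x i <;> simpa [flipCoord_apply, hxi] using e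
        · intro j _ hj
          simp [flipCoord_apply, hj]
        · simp
      · rw [ind_of_not hx, zero_add]; exact ind_le_one _
    linarith
  have hconst : ∀ y, P y = P x := fun y => by simp [hα, hzero]
  by_contra hx
  have : prob (fun x => P x = 0) = 0 :=
    Finset.expect_eq_zero fun y _ => ind_of_not fun h => hx ((hconst y).symm.trans h)
  linarith

end affine

/-! ### A small-set expansion inequality -/

/-- The extremal case ρ = 1/4 of `two_point_diag`, squared. The difference of the two sides is (a -
b)^2 times a form that is nonnegative for a, b ≥ 0. -/
theorem two_point_polynomial {a b : ℝ} (ha : 0 ≤ a) (hb : 0 ≤ b) :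
    (5 * a ^ 6 + 6 * (a ^ 3 * b ^ 3) + 5 * b ^ 6) ^ 2 ≤ 32 * (a ^ 4 + b ^ 4) ^ 3 := by
  have h1 : ∀ u v : ℝ, 0 ≤ 14 * u ^ 2 - 32 * (u * v) + 27 * v ^ 2 := fun u v => by
    nlinarith [sq_nonneg (14 * u - 16 * v), sq_nonneg v]
  have h2 : 32 * (a ^ 4 + b ^ 4) ^ 3 - (5 * a ^ 6 + 6 * (a ^ 3 * b ^ 3) + 5 * b ^ 6) ^ 2 =
      (a - b) ^ 2 * (7 * a ^ 10 + 21 * (a ^ 8 * b ^ 2) + 11 * (a ^ 6 * b ^ 4) +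
        11 * (a ^ 4 * b ^ 6) + 21 * (a ^ 2 * b ^ 8) + 7 * b ^ 10 +
        a ^ 5 * b * (14 * (a ^ 2) ^ 2 - 32 * (a ^ 2 * b ^ 2) + 27 * (b ^ 2) ^ 2) +
        a * b ^ 5 * (14 * (b ^ 2) ^ 2 - 32 * (b ^ 2 * a ^ 2) + 27 * (a ^ 2) ^ 2)) := by
    ring
  have h3 := h1 (a ^ 2) (b ^ 2)
  have h4 := h1 (b ^ 2) (a ^ 2)
  rw [← sub_nonneg, h2]
  positivity

/-- The case of two equal functions. The left side grows with ρ, at rate (a^3 - b^3)^2 / 4, so ρ =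
1/4 is the worst case. -/
theorem two_point_diag {a b p ρ : ℝ} (ha : 0 ≤ a) (hb : 0 ≤ b) (hρ : ρ ≤ 1 / 4)
    (h : (a ^ 4 + b ^ 4) / 2 ≤ p ^ 4) :
    (1 + ρ) / 4 * (a ^ 6 + b ^ 6) + (1 - ρ) / 2 * (a ^ 3 * b ^ 3) ≤ p ^ 6 := by
  have h1 : (1 + ρ) / 4 * (a ^ 6 + b ^ 6) + (1 - ρ) / 2 * (a ^ 3 * b ^ 3) ≤
      (5 * a ^ 6 + 6 * (a ^ 3 * b ^ 3) + 5 * b ^ 6) / 16 := by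
    nlinarith [mul_nonneg (sub_nonneg.2 hρ) (sq_nonneg (a ^ 3 - b ^ 3))]
  refine h1.trans (le_of_sq_le_sq ?_ (by positivity))
  have h2 : ((a ^ 4 + b ^ 4) / 2) ^ 3 ≤ (p ^ 4) ^ 3 := pow_le_pow_left₀ (by positivity) h 3
  have h3 := two_point_polynomial ha hb
  have h4 : (p ^ 6) ^ 2 = (p ^ 4) ^ 3 := by ring
  rw [h4, div_pow]
  rw [div_pow] at h2
  linarith

/-- The two-point inequality behind `expect_mul_le_of_correlation`. -/
theorem two_point {a b c d p q ρ : ℝ} (ha : 0 ≤ a) (hb : 0 ≤ b) (hc : 0 ≤ c) (hd : 0 ≤ d)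
    (hp : 0 ≤ p) (hq : 0 ≤ q) (hρ₀ : 0 ≤ ρ) (hρ : ρ ≤ 1 / 4)
    (hab : (a ^ 4 + b ^ 4) / 2 ≤ p ^ 4) (hcd : (c ^ 4 + d ^ 4) / 2 ≤ q ^ 4) :
    (1 + ρ) / 4 * (a ^ 3 * c ^ 3 + b ^ 3 * d ^ 3) +
      (1 - ρ) / 4 * (a ^ 3 * d ^ 3 + b ^ 3 * c ^ 3) ≤ p ^ 3 * q ^ 3 := by
  have h1 := two_point_diag ha hb hρ hab
  have h2 := two_point_diag hc hd hρ hcd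
  refine le_of_sq_le_sq ?_ (by positivity)
  have h3 : ((1 + ρ) / 4 * (a ^ 6 + b ^ 6) + (1 - ρ) / 2 * (a ^ 3 * b ^ 3)) *
      ((1 + ρ) / 4 * (c ^ 6 + d ^ 6) + (1 - ρ) / 2 * (c ^ 3 * d ^ 3)) ≤ p ^ 6 * q ^ 6 := by
    have : 0 ≤ 1 - ρ := by linarith
    exact mul_le_mul h1 h2 (by positivity) (by positivity)
  have h4 : (p ^ 3 * q ^ 3) ^ 2 = p ^ 6 * q ^ 6 := by ring
  rw [h4]
  refine le_trans ?_ h3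
  rw [← sub_nonneg]
  -- Cauchy–Schwarz for the form with entries (1 ± ρ)/4, whose determinant is ρ/4; this reduces the
  -- general case to the diagonal one and uses ρ ≥ 0.
  have h5 : ((1 + ρ) / 4 * (a ^ 6 + b ^ 6) + (1 - ρ) / 2 * (a ^ 3 * b ^ 3)) *
      ((1 + ρ) / 4 * (c ^ 6 + d ^ 6) + (1 - ρ) / 2 * (c ^ 3 * d ^ 3)) -
      ((1 + ρ) / 4 * (a ^ 3 * c ^ 3 + b ^ 3 * d ^ 3) +
        (1 - ρ) / 4 * (a ^ 3 * d ^ 3 + b ^ 3 * c ^ 3)) ^ 2 =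
      ρ / 4 * (a ^ 3 * d ^ 3 - b ^ 3 * c ^ 3) ^ 2 := by ring
  rw [h5]
  positivity

theorem expect_cons {n : ℕ} {T : Type*} [Fintype T] (F : (Fin (n + 1) → T) → ℝ) :
    𝔼 s, F s = 𝔼 t, 𝔼 s, F (Fin.cons t s) := by
  rw [← expect_prod fun ω : T × (Fin n → T) => F (Fin.cons ω.1 ω.2)]
  exact (Fintype.expect_equiv (Fin.consEquiv fun _ => T) _ _ fun _ => rfl).symm

theorem expect_comp_pair {T : Type*} [Fintype T] (φ ψ : T → Bool) (H : Bool → Bool → ℝ) :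
    𝔼 t, H (φ t) (ψ t) = ∑ b, ∑ b', prob (fun t => φ t = b ∧ ψ t = b') * H b b' := by
  unfold prob
  simp_rw [Finset.expect_mul, ← Finset.expect_sum_comm]
  refine Finset.expect_congr rfl fun t _ => ?_
  cases hφ : φ t <;> cases hψ : ψ t <;> simp [ind]

theorem expect_bool (f : Bool → ℝ) : 𝔼 b, f b = (f true + f false) / 2 := by
  rw [Fintype.expect_eq_sum_div_card, Fintype.sum_bool, Fintype.card_bool, Nat.cast_ofNat]

theorem exists_fourth_root {a : ℝ} (ha : 0 ≤ a) : ∃ x : ℝ, 0 ≤ x ∧ x ^ 4 = a :=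
  ⟨√√a, Real.sqrt_nonneg _, by
    rw [show (4 : ℕ) = 2 * 2 from rfl, pow_mul, Real.sq_sqrt (Real.sqrt_nonneg _),
      Real.sq_sqrt ha]⟩

/-- The dimension-zero case of the expansion inequality, and the place where the bound of the
functions by 1 enters. -/
theorem le_cube_of_le_fourth {a p : ℝ} (ha : a ≤ 1) (hp : 0 ≤ p) (h : a ≤ p ^ 4) : a ≤ p ^ 3 := by
  rcases le_total p 1 with hp1 | hp1
  · exact h.trans (pow_le_pow_of_le_one hp hp1 (by norm_num))
  · exact ha.trans (one_le_pow₀ hp1)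

/-- Small-set expansion: if the coordinates of a pair of points of the cube are independent, each
coordinate pair being uniform on both sides with correlation at most `1/4`, then
`𝔼 f(u) g(v) ≤ (𝔼 f · 𝔼 g)^(3/4)` for `[0,1]`-valued functions `f`, `g`. -/
theorem expect_mul_le_of_correlation {T : Type*} [Fintype T] [Nonempty T] (φ ψ : T → Bool) {ρ : ℝ}
    (hρ₀ : 0 ≤ ρ) (hρ : ρ ≤ 1 / 4)
    (hcorr : ∀ b b', prob (fun t => φ t = b ∧ ψ t = b') = if b = b' then (1 + ρ) / 4
      else (1 - ρ) / 4) {n : ℕ} (f g : Cube n → ℝ) (hf₀ : ∀ x, 0 ≤ f x) (hf₁ : ∀ x, f x ≤ 1)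
    (hg₀ : ∀ x, 0 ≤ g x) (hg₁ : ∀ x, g x ≤ 1) {p q : ℝ} (hp : 0 ≤ p) (hq : 0 ≤ q)
    (hf : 𝔼 x, f x ≤ p ^ 4) (hg : 𝔼 x, g x ≤ q ^ 4) :
    𝔼 s : Fin n → T, f (φ ∘ s) * g (ψ ∘ s) ≤ p ^ 3 * q ^ 3 := by
  induction n generalizing p q with
  | zero =>
    refine Finset.expect_le Finset.univ_nonempty fun s _ => ?_
    have h1 : 𝔼 x, f x = f (φ ∘ s) :=
      (Finset.expect_congr rfl fun x _ => by rw [Subsingleton.elim x (φ ∘ s)]).trans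
        (Fintype.expect_const _)
    have h2 : 𝔼 x, g x = g (ψ ∘ s) :=
      (Finset.expect_congr rfl fun x _ => by rw [Subsingleton.elim x (ψ ∘ s)]).trans
        (Fintype.expect_const _)
    exact mul_le_mul (le_cube_of_le_fourth (hf₁ _) hp (h1 ▸ hf))
      (le_cube_of_le_fourth (hg₁ _) hq (h2 ▸ hg)) (hg₀ _) (by positivity)
  | succ n ih =>
    -- Tensorisation: the induction hypothesis applies to the restrictions to each value of the
    -- first coordinate, with the fourth roots of their means in the role of p and q; `two_point`
    -- then handles that coordinate.
    have key : ∀ f : Cube (n + 1) → ℝ, (∀ x, 0 ≤ f x) → ∃ x : Bool → ℝ, (∀ b, 0 ≤ x b) ∧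
        ∀ b, 𝔼 y : Cube n, f (Fin.cons b y) = x b ^ 4 := by
      intro f hf
      have h b := exists_fourth_root (a := 𝔼 y : Cube n, f (Fin.cons b y))
        (Finset.expect_nonneg fun y _ => hf _)
      choose x hx hx' using h
      exact ⟨x, hx, fun b => (hx' b).symm⟩
    obtain ⟨x, hx₀, hx⟩ := key f hf₀
    obtain ⟨y, hy₀, hy⟩ := key g hg₀
    rw [expect_cons, expect_bool, hx, hx] at hf
    rw [expect_cons, expect_bool, hy, hy] at hg
    rw [expect_cons]
    calc 𝔼 t : T, 𝔼 s : Fin n → T, f (φ ∘ Fin.cons t s) * g (ψ ∘ Fin.cons t s)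
        ≤ 𝔼 t : T, x (φ t) ^ 3 * y (ψ t) ^ 3 := by
          refine expect_mono fun t => ?_
          have := ih (fun u => f (Fin.cons (φ t) u)) (fun u => g (Fin.cons (ψ t) u))
            (fun _ => hf₀ _) (fun _ => hf₁ _) (fun _ => hg₀ _) (fun _ => hg₁ _) (hx₀ (φ t))
            (hy₀ (ψ t)) (hx _).le (hy _).le
          simpa only [Fin.comp_cons] using this
      _ ≤ p ^ 3 * q ^ 3 := by
          rw [expect_comp_pair φ ψ fun b b' => x b ^ 3 * y b' ^ 3]
          simp only [hcorr, Fintype.sum_bool]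
          have := two_point (hx₀ true) (hx₀ false) (hy₀ true) (hy₀ false) hp hq hρ₀ hρ hf hg
          refine le_of_eq_of_le ?_ this
          simp
          ring

/-! ### Super-linear error reduction with nine queries -/

/-- The three points `w`, `y`, `z` of the cube with `x = y + z - w`, where `w` is random and `y`,
`z` are obtained from `x`, `w` by swapping random coordinates; here one coordinate of them, given
the coordinate `b` of `x` and the two random bits `t`. -/
def swapBit (j : Fin 3) (b : Bool) (t : Bool × Bool) : Bool :=
  if j = 0 then t.1 else if (j = 1) = (t.2 = true) then b else t.1

/-- The `a`-th of three entries. -/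
def entry {X : Type*} (a : Fin 3) (t : X × X × X) : X :=
  if a = 0 then t.1 else if a = 1 then t.2.1 else t.2.2

/-- The value at `x` computed from the values at the three points `w`, `y`, `z`. -/
def swapValue {G : Type*} [AddCommGroup G] (v : Fin 3 → G) : G := v 1 + v 2 - v 0

/-- An estimate that is correct if at most one of the three given estimates is wrong. -/
noncomputable def majority {G : Type*} (e : Fin 3 → G) : G :=
  open Classical in if e 0 = e 1 then e 0 else e 2

/-- The index c runs over the pairs (0,1), (0,2), (1,2) of estimates; `![0, 0, 1]` and `![1, 2, 2]`
list their two members. -/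
theorem majority_ne {G : Type*} {e : Fin 3 → G} {g : G} (h : majority e ≠ g) :
    ∃ c : Fin 3, e (![0, 0, 1] c) ≠ g ∧ e (![1, 2, 2] c) ≠ g := by
  unfold majority at h
  split_ifs at h with h01
  · exact ⟨0, h, by simpa [← h01] using h⟩
  · by_cases h0 : e 0 = g
    · exact ⟨2, by simpa using fun h1 => h01 (h0.trans h1.symm), h⟩
    · exact ⟨1, h0, h⟩

/-- Out of 128 outcomes, 32 is independence, while 40 and 24 are (1 ± 1/4)/4. A bit of w ignores x,
and a bit of y or z copies x with probability 1/2, so two such bits from different estimates both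
copy x with probability 1/4 and are otherwise independent. -/
theorem card_swapBit_pair : ∀ (c j j' : Fin 3) (b b' : Bool),
    (Finset.univ.filter fun t : ((Bool × Bool) × (Bool × Bool) × (Bool × Bool)) × Bool =>
      swapBit j t.2 (entry (![0, 0, 1] c) t.1) = b ∧
        swapBit j' t.2 (entry (![1, 2, 2] c) t.1) = b').card =
      if j = 0 ∨ j' = 0 then 32 else if b = b' then 40 else 24 := by
  decide +kernel

theorem IsAffine.swapValue_eq {n : ℕ} {G : Type*} [AddCommGroup G] {P : Cube n → G}
    (hP : IsAffine P) (x : Cube n) (r : Fin n → Bool × Bool) :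
    swapValue (fun j => P fun i => swapBit j (x i) (r i)) = P x := by
  have := hP.sum_zsmul ![-1, 1, 1] (fun j i => swapBit j (x i) (r i)) x
    (by simp [Fin.sum_univ_three]) (fun i => by
      have : ∀ (b : Bool) (t : Bool × Bool), ∑ j : Fin 3, (![-1, 1, 1] : Fin 3 → ℤ) j *
          ((swapBit j b t).toNat : ℤ) = b.toNat := by decide
      exact this _ _)
  rw [← this, Fin.sum_univ_three, swapValue]
  simp
  abel

section swap

variable {n : ℕ} {G : Type*} [AddCommGroup G]

/-- Regrouped by coordinate, the seed and x form n independent tuples, so small-set expansion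
applies to the indicator of B taken twice. The randomness of x makes both points uniform. -/
theorem prob_swap_pair_le {B : Cube n → Prop} {p : ℝ} (hp : 0 ≤ p) (hB : prob B ≤ p ^ 4)
    (c j j' : Fin 3) :
    prob (fun ω : (Fin n → (Bool × Bool) × (Bool × Bool) × (Bool × Bool)) × Cube n =>
      B (fun i => swapBit j (ω.2 i) (entry (![0, 0, 1] c) (ω.1 i))) ∧
        B (fun i => swapBit j' (ω.2 i) (entry (![1, 2, 2] c) (ω.1 i)))) ≤ p ^ 6 := by
  rw [← prob_equiv (Equiv.arrowProdEquivProdArrow (Fin n)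
    (fun _ => (Bool × Bool) × (Bool × Bool) × (Bool × Bool)) (fun _ => Bool))]
  unfold prob
  simp_rw [ind_and]
  have hp6 : p ^ 6 = p ^ 3 * p ^ 3 := by ring
  rw [hp6]
  refine expect_mul_le_of_correlation
    (T := ((Bool × Bool) × (Bool × Bool) × (Bool × Bool)) × Bool)
    (fun t => swapBit j t.2 (entry (![0, 0, 1] c) t.1))
    (fun t => swapBit j' t.2 (entry (![1, 2, 2] c) t.1))
    (ρ := if j = 0 ∨ j' = 0 then 0 else 1 / 4) ?_ ?_ ?_ (fun x => ind (B x)) (fun x => ind (B x))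
    (fun _ => ind_nonneg _) (fun _ => ind_le_one _) (fun _ => ind_nonneg _)
    (fun _ => ind_le_one _) hp hp hB hB
  · split_ifs <;> norm_num
  · split_ifs <;> norm_num
  · intro b b'
    rw [prob_eq_card_div, card_swapBit_pair]
    simp only [Fintype.card_prod, Fintype.card_bool]
    split_ifs <;> norm_num

/-- One round of error reduction: `σ⁴ ↦ σ⁵`. -/
theorem hasReduction_swap {σ : ℝ} (hσ : 0 < σ) :
    HasReduction (polyDegLE n G 1) (σ ^ 4) (σ ^ 5) (27 * σ) 9 := by
  have := hasReduction_of_expect_le (ℱ := polyDegLE n G 1) (δ := σ ^ 4) (δ' := σ ^ 5)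
    (η := 27 * σ) (ι := Fin 3 × Fin 3)
    (Fin n → (Bool × Bool) × (Bool × Bool) × (Bool × Bool))
    (fun r x aj i => swapBit aj.2 (x i) (entry aj.1 (r i)))
    (fun v => majority fun a => swapValue fun j => v (a, j)) (by positivity) ?_
  · simpa using this
  intro f P hP hf
  rw [relDist_eq_prob] at hf
  have hPa := isAffine_of_mem_polyDegLE hP
  have hbad : ∀ (r : Fin n → (Bool × Bool) × (Bool × Bool) × (Bool × Bool)) (x : Cube n)
      (a : Fin 3), swapValue (fun j => f fun i => swapBit j (x i) (entry a (r i))) ≠ P x →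
      ∃ j, f (fun i => swapBit j (x i) (entry a (r i))) ≠
        P fun i => swapBit j (x i) (entry a (r i)) := by
    intro r x a h
    by_contra! hj
    exact h (by simp_rw [hj]; exact hPa.swapValue_eq x fun i => entry a (r i))
  calc _ ≤ prob (fun ω : (Fin n → (Bool × Bool) × (Bool × Bool) × (Bool × Bool)) × Cube n =>
        ∃ c : Fin 3 × Fin 3 × Fin 3,
          (fun y => f y ≠ P y) (fun i => swapBit c.2.1 (ω.2 i) (entry (![0, 0, 1] c.1) (ω.1 i))) ∧
          (fun y => f y ≠ P y)
            (fun i => swapBit c.2.2 (ω.2 i) (entry (![1, 2, 2] c.1) (ω.1 i)))) := by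
        refine prob_mono fun ω hω => ?_
        obtain ⟨c, h1, h2⟩ := majority_ne hω
        obtain ⟨j, hj⟩ := hbad _ _ _ h1
        obtain ⟨j', hj'⟩ := hbad _ _ _ h2
        exact ⟨(c, j, j'), hj, hj'⟩
    _ ≤ ∑ _c : Fin 3 × Fin 3 × Fin 3, σ ^ 6 :=
        (prob_exists_le _).trans (Finset.sum_le_sum fun c _ =>
          prob_swap_pair_le hσ.le hf c.1 c.2.1 c.2.2)
    -- There are 3 pairs of estimates and 3 · 3 choices of a wrong point in each; one factor σ is
    -- left for Markov's inequality.
    _ = 27 * σ * σ ^ 5 := by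
        simp
        ring

/-- Iterated error reduction. -/
theorem hasReduction_iterate (T : ℕ) :
    HasReduction (polyDegLE n G 1) (((2 : ℝ) ^ (-12 : ℝ)) ^ 4)
      (((2 : ℝ) ^ (-12 * (5 / 4) ^ T : ℝ)) ^ 4) ((1 - (1 / 8) ^ T) / 64) (9 ^ T) := by
  induction T with
  | zero =>
    simp only [pow_zero, mul_one, sub_self, zero_div]
    exact HasReduction.refl _ _
  | succ T ih =>
    have hσ : (0 : ℝ) < 2 ^ (-12 * (5 / 4) ^ T : ℝ) := by positivity
    have h1 := ih.trans (hasReduction_swap (n := n) (G := G) hσ) (by positivity)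
    have h2 : ((2 : ℝ) ^ (-12 * (5 / 4) ^ T : ℝ)) ^ 5 =
        (2 ^ (-12 * (5 / 4) ^ (T + 1) : ℝ)) ^ 4 := by
      rw [← Real.rpow_mul_natCast (by norm_num), ← Real.rpow_mul_natCast (by norm_num)]
      congr 1
      push_cast
      ring
    -- Bernoulli's inequality (5/4)^T ≥ 1 + T/4 makes the failure probabilities geometric. Their sum
    -- stays below 1/64 because 27/4096 ≤ 7/512.
    have h3 : (2 : ℝ) ^ (-12 * (5 / 4) ^ T : ℝ) ≤ 2 ^ (-12 : ℝ) * (1 / 8) ^ T := by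
      have : ((1 : ℝ) / 8) ^ T = 2 ^ (-3 * T : ℝ) := by
        rw [Real.rpow_mul (by norm_num), Real.rpow_natCast]
        congr 1
        rw [Real.rpow_neg (by norm_num)]
        norm_num
      rw [this, ← Real.rpow_add (by norm_num)]
      refine Real.rpow_le_rpow_of_exponent_le (by norm_num) ?_
      have := one_add_mul_le_pow (a := (1 / 4 : ℝ)) (by norm_num) T
      norm_num at this ⊢
      linarith
    have h4 : (2 : ℝ) ^ (-12 : ℝ) = 1 / 4096 := by
      rw [Real.rpow_neg (by norm_num)]
      norm_num
    rw [h2] at h1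
    refine (h1.mono le_rfl ?_)
    rw [h4] at h3
    have h5 : (0 : ℝ) < (1 / 8) ^ T := by positivity
    rw [pow_succ]
    linarith

end swap

/-! ### Fourier analysis on the cube and sampling by random subcubes -/

/-- The sign `(-1)^b`. -/
def boolSign (b : Bool) : ℝ := if b then -1 else 1

theorem boolSign_xor (a b : Bool) : boolSign (xor a b) = boolSign a * boolSign b := by
  cases a <;> cases b <;> simp [boolSign]

theorem boolSign_mul_self (a : Bool) : boolSign a * boolSign a = 1 := by
  cases a <;> simp [boolSign]

section fourier

variable {n : ℕ}

/-- The characters of the cube. -/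
def cubeChar (S : Finset (Fin n)) (x : Cube n) : ℝ := ∏ i ∈ S, boolSign (x i)

theorem cubeChar_xor (S : Finset (Fin n)) (x y : Cube n) :
    cubeChar S (fun i => xor (x i) (y i)) = cubeChar S x * cubeChar S y := by
  simp_rw [cubeChar, boolSign_xor, Finset.prod_mul_distrib]

theorem cubeChar_mul_self (S : Finset (Fin n)) (x : Cube n) :
    cubeChar S x * cubeChar S x = 1 := by
  simp_rw [cubeChar, ← Finset.prod_mul_distrib, boolSign_mul_self, Finset.prod_const_one]

theorem cubeChar_eq_or (S : Finset (Fin n)) (x : Cube n) :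
    cubeChar S x = 1 ∨ cubeChar S x = -1 :=
  mul_self_eq_one_iff.1 (cubeChar_mul_self S x)

theorem sum_cubeChar_mul (x y : Cube n) :
    ∑ S, cubeChar S x * cubeChar S y = if y = x then 2 ^ n else 0 := by
  have h : ∑ S, cubeChar S x * cubeChar S y = ∏ i, (1 + boolSign (x i) * boolSign (y i)) := by
    rw [Finset.prod_one_add, Finset.powerset_univ]
    simp_rw [cubeChar, Finset.prod_mul_distrib]
  rw [h]
  split_ifs with hxy
  · subst hxy
    simp_rw [boolSign_mul_self]
    norm_num
  · obtain ⟨i, hi⟩ := Function.ne_iff.1 hxy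
    refine Finset.prod_eq_zero (Finset.mem_univ i) ?_
    cases hx : x i <;> cases hy : y i <;> simp_all [boolSign]

/-- The Fourier coefficients of a function on the cube. -/
noncomputable def cubeCoeff (f : Cube n → ℝ) (S : Finset (Fin n)) : ℝ :=
  𝔼 x, f x * cubeChar S x

theorem cubeCoeff_empty (f : Cube n → ℝ) : cubeCoeff f ∅ = 𝔼 x, f x := by
  simp [cubeCoeff, cubeChar]

theorem sum_cubeCoeff_sq (f : Cube n → ℝ) : ∑ S, cubeCoeff f S ^ 2 = 𝔼 x, f x ^ 2 := by
  have h : ∀ S, cubeCoeff f S ^ 2 =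
      𝔼 x, 𝔼 y, f x * f y * (cubeChar S x * cubeChar S y) := by
    intro S
    rw [sq, cubeCoeff, Fintype.expect_mul_expect]
    refine Finset.expect_congr rfl fun x _ => Finset.expect_congr rfl fun y _ => by ring
  simp_rw [h, ← Finset.expect_sum_comm, ← Finset.mul_sum, sum_cubeChar_mul]
  refine Finset.expect_congr rfl fun x _ => ?_
  rw [Fintype.expect_eq_sum_div_card]
  simp [sq]

/-- Translation of the cube. -/
def xorEquiv (a : Cube n) : Equiv.Perm (Cube n) :=
  Function.Involutive.toPerm (fun x i => xor (x i) (a i)) fun x => by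
    funext i
    simp

theorem expect_xor (a : Cube n) (f : Cube n → ℝ) :
    𝔼 x : Cube n, f (fun i => xor (x i) (a i)) = 𝔼 x, f x :=
  Fintype.expect_equiv (xorEquiv a) _ _ fun _ => rfl

variable {k : ℕ}

/-- The point `y` of the subcube with origin `x` and coordinate blocks given by `h`. -/
def subcubePoint (h : Fin n → Fin k) (x : Cube n) (y : Cube k) : Cube n :=
  fun i => xor (x i) (y (h i))

/-- The average of `f` over the subcube with origin `x` and coordinate blocks given by `h`. -/
noncomputable def subcubeMean (f : Cube n → ℝ) (h : Fin n → Fin k) (x : Cube n) : ℝ :=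
  𝔼 y : Cube k, f (subcubePoint h x y)

/-- The factor by which averaging over subcubes changes a Fourier coefficient. -/
noncomputable def subcubeFactor (h : Fin n → Fin k) (S : Finset (Fin n)) : ℝ :=
  𝔼 y : Cube k, cubeChar S (y ∘ h)

/-- The subcube mean averages the translates of f by y ∘ h, so it is diagonal in the basis of
characters. -/
theorem cubeCoeff_subcubeMean (f : Cube n → ℝ) (h : Fin n → Fin k) (S : Finset (Fin n)) :
    cubeCoeff (subcubeMean f h) S = cubeCoeff f S * subcubeFactor h S := by
  have h1 : ∀ y : Cube k, 𝔼 x, f (subcubePoint h x y) * cubeChar S x =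
      cubeCoeff f S * cubeChar S (y ∘ h) := by
    intro y
    have h2 : ∀ x, f (subcubePoint h x y) * cubeChar S x =
        (fun x => f x * cubeChar S x * cubeChar S (y ∘ h)) (fun i => xor (x i) ((y ∘ h) i)) := by
      intro x
      simp only [cubeChar_xor]
      rw [mul_assoc, mul_assoc, cubeChar_mul_self, mul_one]
      rfl
    exact (Finset.expect_congr rfl fun x _ => h2 x).trans
      ((expect_xor (y ∘ h) fun x => f x * cubeChar S x * cubeChar S (y ∘ h)).trans
        (Finset.expect_mul _ _ _).symm)
  unfold cubeCoeff subcubeMean subcubeFactor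
  simp_rw [Finset.expect_mul]
  rw [Finset.expect_comm]
  simp_rw [h1, ← Finset.mul_expect]
  rw [cubeCoeff, Finset.expect_mul]

theorem expect_subcubeMean (f : Cube n → ℝ) (h : Fin n → Fin k) :
    𝔼 x, subcubeMean f h x = 𝔼 x, f x := by
  rw [← cubeCoeff_empty, cubeCoeff_subcubeMean, cubeCoeff_empty]
  simp [subcubeFactor, cubeChar]

theorem subcubeFactor_sq_le_one (h : Fin n → Fin k) (S : Finset (Fin n)) :
    subcubeFactor h S ^ 2 ≤ 1 := by
  rw [sq_le_one_iff_abs_le_one]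
  refine (Finset.abs_expect_le _ _).trans (Finset.expect_le Finset.univ_nonempty fun y _ => ?_)
  rcases cubeChar_eq_or S (y ∘ h) with h | h <;> simp [h]

/-- The factor is the mean of a character of `Cube k`, and translation invariance makes the mean of
a nontrivial character zero. -/
theorem cubeChar_eq_one_of_subcubeFactor_ne_zero {h : Fin n → Fin k} {S : Finset (Fin n)}
    (hS : subcubeFactor h S ≠ 0) (y : Cube k) : cubeChar S (y ∘ h) = 1 := by
  refine (cubeChar_eq_or S (y ∘ h)).resolve_right fun hy => hS ?_
  have h1 : subcubeFactor h S = subcubeFactor h S * cubeChar S (y ∘ h) := by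
    conv_lhs => unfold subcubeFactor
    rw [← expect_xor y, subcubeFactor, Finset.expect_mul]
    exact Finset.expect_congr rfl fun z _ => cubeChar_xor S (z ∘ h) (y ∘ h)
  rw [hy] at h1
  linarith

/-- A nonzero factor forces every block to meet S in an even number of coordinates, and moving i
from block c to block d breaks the parity at c. The test point is the indicator of block c. -/
theorem subcubeFactor_update_eq_zero {h : Fin n → Fin k} {S : Finset (Fin n)} {i : Fin n}
    (hi : i ∈ S) {c d : Fin k} (hcd : c ≠ d)
    (hc : subcubeFactor (Function.update h i c) S ≠ 0) :
    subcubeFactor (Function.update h i d) S = 0 := by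
  by_contra hd
  have h1 := cubeChar_eq_one_of_subcubeFactor_ne_zero hc fun j => decide (j = c)
  have h2 := cubeChar_eq_one_of_subcubeFactor_ne_zero hd fun j => decide (j = c)
  have h3 : ∏ j ∈ S.erase i, boolSign (((fun j => decide (j = c)) ∘ Function.update h i c) j) =
      ∏ j ∈ S.erase i, boolSign (((fun j => decide (j = c)) ∘ Function.update h i d) j) :=
    Finset.prod_congr rfl fun j hj => by simp [Finset.ne_of_mem_erase hj]
  rw [cubeChar, ← Finset.mul_prod_erase _ _ hi, h3] at h1
  rw [cubeChar, ← Finset.mul_prod_erase _ _ hi] at h2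
  simp [boolSign, hcd.symm] at h1 h2
  linarith

/-- Only the block of a single i ∈ S is rerandomised, by a cyclic shift: at most one of its k values
leaves a nonzero factor. -/
theorem expect_subcubeFactor_sq_le [NeZero k] {S : Finset (Fin n)} (hS : S.Nonempty) :
    𝔼 h : Fin n → Fin k, subcubeFactor h S ^ 2 ≤ 1 / k := by
  obtain ⟨i, hi⟩ := hS
  have hshift : ∀ c : Fin k, 𝔼 h : Fin n → Fin k, subcubeFactor h S ^ 2 =
      𝔼 h : Fin n → Fin k, subcubeFactor (Function.update h i (h i + c)) S ^ 2 := by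
    intro c
    let e : Equiv.Perm (Fin n → Fin k) :=
      { toFun := fun h => Function.update h i (h i + c)
        invFun := fun h => Function.update h i (h i - c)
        left_inv := fun h => by simp
        right_inv := fun h => by simp }
    exact (Fintype.expect_equiv e _ _ fun _ => rfl).symm
  have havg : 𝔼 h : Fin n → Fin k, subcubeFactor h S ^ 2 =
      𝔼 h : Fin n → Fin k, 𝔼 c, subcubeFactor (Function.update h i (h i + c)) S ^ 2 := by
    rw [Finset.expect_comm]
    simp_rw [← hshift]
    rw [Fintype.expect_const]
  rw [havg]
  refine Finset.expect_le Finset.univ_nonempty fun h _ => ?_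
  rw [Fintype.expect_eq_sum_div_card, Fintype.card_fin]
  refine div_le_div_of_nonneg_right ?_ (Nat.cast_nonneg k)
  by_cases hex : ∃ c, subcubeFactor (Function.update h i (h i + c)) S ≠ 0
  · obtain ⟨c, hc⟩ := hex
    rw [Finset.sum_eq_single c]
    · exact subcubeFactor_sq_le_one _ _
    · intro d _ hd
      rw [subcubeFactor_update_eq_zero hi (fun e => hd (add_left_cancel e).symm) hc]
      norm_num
    · simp
  · push Not at hex
    rw [Finset.sum_eq_zero fun c _ => by rw [hex c]; norm_num]
    norm_num

/-- The variance of the average over a random subcube with `k` blocks is at most `1 / k`. -/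
theorem expect_subcubeMean_sub_sq_le [NeZero k] {f : Cube n → ℝ} (hf₀ : ∀ x, 0 ≤ f x)
    (hf₁ : ∀ x, f x ≤ 1) :
    𝔼 h : Fin n → Fin k, 𝔼 x, (subcubeMean f h x - 𝔼 z, f z) ^ 2 ≤ 1 / k := by
  set μ := 𝔼 z, f z with hμ
  have h1 : ∀ h : Fin n → Fin k, 𝔼 x, (subcubeMean f h x - μ) ^ 2 =
      ∑ S with S ≠ ∅, cubeCoeff f S ^ 2 * subcubeFactor h S ^ 2 := by
    intro h
    have h2 : 𝔼 x, (subcubeMean f h x - μ) ^ 2 = 𝔼 x, subcubeMean f h x ^ 2 - μ ^ 2 := by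
      have : ∀ x, (subcubeMean f h x - μ) ^ 2 =
          subcubeMean f h x ^ 2 - 2 * μ * subcubeMean f h x + μ ^ 2 := fun x => by ring
      simp_rw [this]
      rw [Finset.expect_add_distrib, Finset.expect_sub_distrib, ← Finset.mul_expect,
        expect_subcubeMean, Fintype.expect_const, ← hμ]
      ring
    rw [h2, ← sum_cubeCoeff_sq, ← Finset.add_sum_erase _ _ (Finset.mem_univ ∅), cubeCoeff_empty,
      expect_subcubeMean, ← hμ, add_sub_cancel_left, Finset.filter_ne']
    simp_rw [cubeCoeff_subcubeMean, mul_pow]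
  simp_rw [h1, Finset.expect_sum_comm, ← Finset.mul_expect]
  calc ∑ S with S ≠ ∅, cubeCoeff f S ^ 2 * 𝔼 h : Fin n → Fin k, subcubeFactor h S ^ 2
      ≤ ∑ S with S ≠ ∅, cubeCoeff f S ^ 2 * (1 / k) := by
        refine Finset.sum_le_sum fun S hS => mul_le_mul_of_nonneg_left ?_ (sq_nonneg _)
        exact expect_subcubeFactor_sq_le
          (Finset.nonempty_iff_ne_empty.2 (Finset.mem_filter.1 hS).2)
    _ ≤ ∑ S, cubeCoeff f S ^ 2 * (1 / k) :=
        Finset.sum_le_sum_of_subset_of_nonneg (Finset.filter_subset _ _) fun S _ _ => by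
          positivity
    _ ≤ 1 * (1 / k) := by
        rw [← Finset.sum_mul, sum_cubeCoeff_sq]
        refine mul_le_mul_of_nonneg_right ?_ (by positivity)
        exact Finset.expect_le Finset.univ_nonempty fun x _ => pow_le_one₀ (hf₀ x) (hf₁ x)
    _ = 1 / k := one_mul _

end fourier

/-! ### Unique decoding on a random subcube -/

section subcube

variable {n k : ℕ} {G : Type*} [AddCommGroup G]

/-- Decode a function on a small cube to the value at the origin of an affine function within
distance less than `1/4`. -/
noncomputable def subcubeDecode (v : Cube k → G) : G :=
  open Classical in
  if h : ∃ Q : Cube k → G, IsAffine Q ∧ prob (fun y => v y ≠ Q y) < 1 / 4 then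
    h.choose fun _ => false
  else 0

/-- Two affine functions within distance less than 1/4 of v agree on more than half of the cube,
hence everywhere; the choice made by the decoder is immaterial. -/
theorem subcubeDecode_eq {v Q : Cube k → G} (hQ : IsAffine Q)
    (hv : prob (fun y => v y ≠ Q y) < 1 / 4) : subcubeDecode v = Q fun _ => false := by
  have h : ∃ Q : Cube k → G, IsAffine Q ∧ prob (fun y => v y ≠ Q y) < 1 / 4 := ⟨Q, hQ, hv⟩
  rw [subcubeDecode, dif_pos h]
  obtain ⟨hR, hvR⟩ := h.choose_spec
  set R := h.choose
  refine sub_eq_zero.1 ((hR.sub hQ).eq_zero_of_half_lt ?_ _)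
  have h1 : prob (fun y => ¬(R y - Q y = 0)) ≤
      prob (fun y => v y ≠ R y) + prob fun y => v y ≠ Q y := by
    refine le_trans (prob_mono fun y hy => ?_) (prob_or_le _ _)
    by_contra! hne
    exact hy (sub_eq_zero.2 (hne.1.symm.trans hne.2))
  rw [prob_not] at h1
  linarith

/-- Error reduction from just below the unique decoding radius to a constant. -/
theorem hasReduction_subcube [NeZero k] {ε δ' η : ℝ} (hε : 0 < ε) (hδ' : 0 < δ')
    (hη : 1 ≤ η * δ' * ε ^ 2 * k) :
    HasReduction (polyDegLE n G 1) (1 / 4 - ε) δ' η (2 ^ k) := by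
  have hcard : Fintype.card (Cube k) = 2 ^ k := by simp
  rw [← hcard]
  refine hasReduction_of_expect_le (Fin n → Fin k) (fun h x y => subcubePoint h x y)
    subcubeDecode hδ' fun f P hP hf => ?_
  rw [relDist_eq_prob] at hf
  have hPa := isAffine_of_mem_polyDegLE hP
  have hk : (0 : ℝ) < k := Nat.cast_pos.2 (Nat.pos_of_neZero k)
  set b : Cube n → ℝ := fun x => ind (f x ≠ P x) with hb
  -- A wrong decoding requires error at least 1/4 on the subcube, an excess of ε over the mean;
  -- Chebyshev's inequality over h and x bounds its probability.
  have hbad : ∀ ω : (Fin n → Fin k) × Cube n,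
      subcubeDecode (f ∘ fun y => subcubePoint ω.1 ω.2 y) ≠ P ω.2 →
        ε ≤ subcubeMean b ω.1 ω.2 - 𝔼 z, b z := by
    intro ω hω
    by_contra! hlt
    apply hω
    have hQ : IsAffine fun y : Cube k => P (subcubePoint ω.1 ω.2 y) := hPa.comp_xor ω.2 ω.1
    rw [subcubeDecode_eq hQ]
    · congr 1
      funext i
      simp [subcubePoint]
    · change subcubeMean b ω.1 ω.2 < 1 / 4
      change 𝔼 z, b z ≤ 1 / 4 - ε at hf
      linarith
  have hvar := expect_subcubeMean_sub_sq_le (k := k) (f := b) (fun _ => ind_nonneg _)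
    (fun _ => ind_le_one _)
  have hcheb : prob (fun ω : (Fin n → Fin k) × Cube n =>
      subcubeDecode (f ∘ fun y => subcubePoint ω.1 ω.2 y) ≠ P ω.2) * ε ^ 2 ≤ 1 / k := by
    refine le_trans ?_ hvar
    rw [← expect_prod fun ω : (Fin n → Fin k) × Cube n =>
      (subcubeMean b ω.1 ω.2 - 𝔼 z, b z) ^ 2, prob, Finset.expect_mul]
    refine expect_mono fun ω => ?_
    by_cases hω : subcubeDecode (f ∘ fun y => subcubePoint ω.1 ω.2 y) ≠ P ω.2
    · rw [ind_of hω, one_mul]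
      exact pow_le_pow_left₀ hε.le (hbad ω hω) 2
    · rw [ind_of_not hω, zero_mul]
      exact sq_nonneg _
  refine le_of_mul_le_mul_right (hcheb.trans ?_) (pow_pos hε 2)
  rw [div_le_iff₀ hk]
  exact hη

end subcube

/-! ### Correction at an arbitrary point from a small error -/

theorem expect_comp {T : Type*} [Fintype T] (φ : T → Bool) (H : Bool → ℝ) :
    𝔼 t, H (φ t) = ∑ b, prob (fun t => φ t = b) * H b := by
  unfold prob
  simp_rw [Finset.expect_mul, ← Finset.expect_sum_comm]
  refine Finset.expect_congr rfl fun t _ => ?_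
  cases hφ : φ t <;> simp [ind]

/-- If the coordinates of a random point are independent and take each value with probability at
most `κ / 2`, then the density of the point with respect to the uniform distribution is at most
`κ ^ n`. -/
theorem expect_comp_le_of_density {T : Type*} [Fintype T] [Nonempty T] (φ : T → Bool) {κ : ℝ}
    (hκ : 0 ≤ κ) (hφ : ∀ b, prob (fun t => φ t = b) ≤ κ / 2) {n : ℕ} (g : Cube n → ℝ)
    (hg : ∀ x, 0 ≤ g x) : 𝔼 s : Fin n → T, g (φ ∘ s) ≤ κ ^ n * 𝔼 x, g x := by
  induction n with
  | zero =>
    have h1 : 𝔼 s : Fin 0 → T, g (φ ∘ s) = g Fin.elim0 :=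
      (Finset.expect_congr rfl fun s _ => by rw [Subsingleton.elim (φ ∘ s) Fin.elim0]).trans
        (Fintype.expect_const _)
    have h2 : 𝔼 x, g x = g Fin.elim0 :=
      (Finset.expect_congr rfl fun x _ => by rw [Subsingleton.elim x Fin.elim0]).trans
        (Fintype.expect_const _)
    rw [h1, h2, pow_zero, one_mul]
  | succ n ih =>
    rw [expect_cons, expect_cons g, expect_bool]
    set H : Bool → ℝ := fun b => 𝔼 x : Cube n, g (Fin.cons b x) with hH
    have hH₀ : ∀ b, 0 ≤ H b := fun b => Finset.expect_nonneg fun x _ => hg _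
    calc 𝔼 t : T, 𝔼 s : Fin n → T, g (φ ∘ Fin.cons t s)
        ≤ 𝔼 t : T, κ ^ n * H (φ t) := by
          refine expect_mono fun t => ?_
          simp_rw [Fin.comp_cons]
          exact ih (fun x => g (Fin.cons (φ t) x)) fun _ => hg _
      _ = κ ^ n * ∑ b, prob (fun t => φ t = b) * H b := by
          rw [← Finset.mul_expect, expect_comp]
      _ ≤ κ ^ n * ∑ b, κ / 2 * H b := by
          gcongr with b
          · exact hH₀ b
          · exact hφ b
      _ = κ ^ (n + 1) * ((H true + H false) / 2) := by
          rw [Fintype.sum_bool]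
          ring

/-- One step of binary addition: the next carry. -/
def carryStep (t : Bool × Bool) (c : Bool) : Bool := (t.1 && t.2) || (c && xor t.1 t.2)

/-- The carry after adding two `m`-bit numbers with initial carry `c`, least significant bits
first. -/
def carryOut : (m : ℕ) → (Fin m → Bool × Bool) → Bool → Bool
  | 0, _, c => c
  | m + 1, t, c => carryOut m (Fin.tail t) (carryStep (t 0) c)

/-- The bits of the sum of two `m`-bit numbers with initial carry `c`. -/
def sumBit : (m : ℕ) → (Fin m → Bool × Bool) → Bool → Fin m → Bool
  | 0, _, _ => Fin.elim0
  | m + 1, t, c => Fin.cons (xor (xor (t 0).1 (t 0).2) c)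
      (sumBit m (Fin.tail t) (carryStep (t 0) c))

theorem sum_sumBit (m : ℕ) (t : Fin m → Bool × Bool) (c : Bool) :
    ∑ j : Fin m, (2 : ℤ) ^ (j : ℕ) * (sumBit m t c j).toNat + 2 ^ m * (carryOut m t c).toNat =
      c.toNat + ∑ j : Fin m, (2 : ℤ) ^ (j : ℕ) * ((t j).1.toNat + (t j).2.toNat) := by
  induction m generalizing c with
  | zero => simp [carryOut]
  | succ m ih =>
    have h := ih (Fin.tail t) (carryStep (t 0) c)
    simp only [Fin.sum_univ_succ, sumBit, carryOut, Fin.cons_zero, Fin.cons_succ, Fin.val_succ,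
      Fin.val_zero, pow_zero, pow_succ, one_mul]
    simp only [Fin.tail] at h
    have hstep : ∀ (p : Bool × Bool) (c : Bool), ((xor (xor p.1 p.2) c).toNat : ℤ) +
        2 * (carryStep p c).toNat = c.toNat + (p.1.toNat + p.2.toNat) := by decide
    have h0 := hstep (t 0) c
    simp_rw [mul_comm _ (2 : ℤ), mul_assoc, ← Finset.mul_sum]
    linarith

/-- A carry survives one step with probability 3/4, whatever its value, so its bias is halved at
each of the m steps. -/
theorem prob_carryOut (m : ℕ) (c b : Bool) :
    prob (fun t : Fin m → Bool × Bool => carryOut m t c = b) =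
      (1 + (if c = b then 1 else -1) / 2 ^ m) / 2 := by
  induction m generalizing c with
  | zero =>
    have : ∀ t : Fin 0 → Bool × Bool, ind (carryOut 0 t c = b) = if c = b then 1 else 0 :=
      fun t => by by_cases h : c = b <;> simp [carryOut, ind, h]
    simp_rw [prob, this, Fintype.expect_const]
    split_ifs <;> norm_num
  | succ m ih =>
    unfold prob
    rw [expect_cons]
    change 𝔼 p : Bool × Bool, prob (fun t : Fin m → Bool × Bool =>
      carryOut m t (carryStep p c) = b) = _
    simp_rw [ih, expect_prod, expect_bool]
    cases c <;> cases b <;> simp [carryStep, pow_succ] <;> ring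

/-- Whatever the incoming carry, it is xored with fresh uniform bits. -/
theorem prob_sumBit (m : ℕ) (c b : Bool) (j : Fin m) :
    prob (fun t : Fin m → Bool × Bool => sumBit m t c j = b) = 1 / 2 := by
  induction m generalizing c with
  | zero => exact j.elim0
  | succ m ih =>
    unfold prob
    rw [expect_cons]
    refine Fin.cases ?_ (fun j => ?_) j
    · simp only [sumBit, Fin.cons_zero, Fintype.expect_const, expect_prod, expect_bool]
      cases c <;> cases b <;> norm_num [ind]
    · change 𝔼 p : Bool × Bool, prob (fun t : Fin m → Bool × Bool =>
        sumBit m t (carryStep p c) j = b) = _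
      simp_rw [ih, Fintype.expect_const]

theorem prob_apply (m : ℕ) {T : Type*} [Fintype T] [Nonempty T] (p : T → Prop) (j : Fin m) :
    prob (fun t : Fin m → T => p (t j)) = prob p := by
  induction m with
  | zero => exact j.elim0
  | succ m ih =>
    unfold prob
    rw [expect_cons]
    refine Fin.cases ?_ (fun j => ?_) j
    · simp only [Fin.cons_zero, Fintype.expect_const]
    · change 𝔼 _ : T, prob (fun t : Fin m → T => p (t j)) = _
      simp_rw [ih, Fintype.expect_const]
      rfl

/-- The bits queried by the corrector: the two summands, their sum, and the final carry. -/
def adderBit {m : ℕ} (q : Option (Fin m × Fin 3)) (t : Fin m → Bool × Bool) : Bool :=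
  match q with
  | none => carryOut m t false
  | some (j, 0) => (t j).1
  | some (j, 1) => (t j).2
  | some (j, 2) => sumBit m t false j

/-- The coefficients with which the corrector combines the queried values. -/
def adderCoeff {m : ℕ} (q : Option (Fin m × Fin 3)) : ℤ :=
  match q with
  | none => 2 ^ m
  | some (j, 0) => -2 ^ (j : ℕ)
  | some (j, 1) => -2 ^ (j : ℕ)
  | some (j, 2) => 2 ^ (j : ℕ)

theorem sum_adderCoeff (m : ℕ) : ∑ q : Option (Fin m × Fin 3), adderCoeff q = 1 := by
  have h : ∑ j : Fin m, (2 : ℤ) ^ (j : ℕ) = 2 ^ m - 1 := by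
    have := geom_sum_mul (2 : ℤ) m
    rw [Fin.sum_univ_eq_sum_range fun j => (2 : ℤ) ^ j]
    linarith
  simp only [Fintype.sum_option, Fintype.sum_prod_type, Fin.sum_univ_three, adderCoeff,
    Finset.sum_add_distrib, Finset.sum_neg_distrib, h]
  ring

/-- This is binary addition with initial carry 0. Together with `sum_adderCoeff` it expresses the
origin as an integer affine combination of the random points. -/
theorem sum_adderCoeff_mul_adderBit {m : ℕ} (t : Fin m → Bool × Bool) :
    ∑ q : Option (Fin m × Fin 3), adderCoeff q * ((adderBit q t).toNat : ℤ) = 0 := by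
  have h := sum_sumBit m t false
  simp only [Fintype.sum_option, Fintype.sum_prod_type, Fin.sum_univ_three, adderCoeff, adderBit,
    Finset.sum_add_distrib, Finset.sum_neg_distrib, neg_mul, mul_add, Bool.toNat_false,
    Nat.cast_zero, zero_add] at h ⊢
  linarith

section adder

variable {n : ℕ} {G : Type*} [AddCommGroup G]

/-- Summand and sum bits are exactly uniform. The carry has bias 2^(-m), so its density is at most
(1 + 2^(-m))^n ≤ e < 3; this is why m must be at least log₂ n. -/
theorem prob_adder_le {m : ℕ} (hm : n ≤ 2 ^ m) (B : Cube n → Prop)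
    (q : Option (Fin m × Fin 3)) :
    prob (fun s : Fin n → Fin m → Bool × Bool => B fun i => adderBit q (s i)) ≤
      (if q = none then 3 else 1) * prob B := by
  have hle : ∀ κ : ℝ, 0 ≤ κ → (∀ b, prob (fun t => adderBit q t = b) ≤ κ / 2) →
      prob (fun s : Fin n → Fin m → Bool × Bool => B fun i => adderBit q (s i)) ≤
        κ ^ n * prob B := fun κ hκ h =>
    expect_comp_le_of_density (adderBit q) hκ h (fun x => ind (B x)) fun _ => ind_nonneg _
  have hone : (∀ b, prob (fun t => adderBit q t = b) = 1 / 2) →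
      prob (fun s : Fin n → Fin m → Bool × Bool => B fun i => adderBit q (s i)) ≤
        1 * prob B := fun h => by
    simpa using hle 1 zero_le_one fun b => (h b).le
  have hbit : ∀ b, prob (fun p : Bool × Bool => p.1 = b) = 1 / 2 ∧
      prob (fun p : Bool × Bool => p.2 = b) = 1 / 2 := fun b => by
    simp_rw [prob, expect_prod, expect_bool]
    cases b <;> norm_num [ind]
  match q with
  | none =>
    refine (hle (1 + 1 / 2 ^ m) (by positivity) fun b => ?_).trans ?_
    · change prob (fun t : Fin m → Bool × Bool => carryOut m t false = b) ≤ _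
      rw [prob_carryOut]
      gcongr
      split_ifs <;> norm_num
    · rw [if_pos rfl]
      refine mul_le_mul_of_nonneg_right ?_ (prob_nonneg B)
      have h2 : (0 : ℝ) < 2 ^ m := by positivity
      calc (1 + 1 / 2 ^ m : ℝ) ^ n ≤ Real.exp (1 / 2 ^ m) ^ n := by
            gcongr
            rw [add_comm]
            exact Real.add_one_le_exp _
        _ = Real.exp (n / 2 ^ m) := by rw [← Real.exp_nat_mul]; congr 1; ring
        _ ≤ Real.exp 1 := Real.exp_le_exp.2 ((div_le_one h2).2 (by exact_mod_cast hm))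
        _ ≤ 3 := by linarith [Real.exp_one_lt_d9]
  | some (j, 0) =>
    simpa using hone fun b => (prob_apply m (fun p : Bool × Bool => p.1 = b) j).trans (hbit b).1
  | some (j, 1) =>
    simpa using hone fun b => (prob_apply m (fun p : Bool × Bool => p.2 = b) j).trans (hbit b).2
  | some (j, 2) =>
    simpa using hone fun b => prob_sumBit m false b j

/-- Local correction from error `O(1 / log n)` with `O(log n)` queries. -/
theorem hasCorrection_adder {m : ℕ} (hm : n ≤ 2 ^ m) (δ : ℝ) :
    HasCorrection (polyDegLE n G 1) δ ((3 * m + 3) * δ) (3 * m + 1) := by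
  have hcard : Fintype.card (Option (Fin m × Fin 3)) = 3 * m + 1 := by simp [mul_comm]
  rw [← hcard]
  refine hasCorrection_of_prob_le (Fin n → Fin m → Bool × Bool)
    (fun s a q i => xor (a i) (adderBit q (s i))) (fun v => ∑ q, adderCoeff q • v q)
    fun f P hP hf a => ?_
  have hPa := isAffine_of_mem_polyDegLE hP
  -- Translation by a moves the target to the origin and preserves the measure of the error set.
  set B : Cube n → Prop := fun x => f (fun i => xor (a i) (x i)) ≠ P fun i => xor (a i) (x i)
    with hBdef
  have hB : prob B = relDist f P := by
    rw [relDist_eq_prob]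
    simp only [hBdef, Bool.xor_comm (a _)]
    exact prob_equiv (xorEquiv a) fun x => f x ≠ P x
  have hdecode : ∀ s : Fin n → Fin m → Bool × Bool,
      ∑ q : Option (Fin m × Fin 3), adderCoeff q • P (fun i => xor (a i) (adderBit q (s i))) =
        P a := by
    intro s
    refine hPa.sum_zsmul adderCoeff _ a (sum_adderCoeff m) fun i => ?_
    have h1 : ∀ q : Option (Fin m × Fin 3),
        adderCoeff q * ((xor (a i) (adderBit q (s i))).toNat : ℤ) = (a i).toNat * adderCoeff q +
          (1 - 2 * ((a i).toNat : ℤ)) * (adderCoeff q * (adderBit q (s i)).toNat) := fun q => by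
      rw [toNat_xor]
      ring
    simp_rw [h1, Finset.sum_add_distrib, ← Finset.mul_sum, sum_adderCoeff_mul_adderBit,
      sum_adderCoeff]
    ring
  calc _ ≤ prob (fun s : Fin n → Fin m → Bool × Bool =>
        ∃ q : Option (Fin m × Fin 3), B fun i => adderBit q (s i)) := by
        refine prob_mono fun s hs => ?_
        by_contra! hq
        apply hs
        rw [← hdecode s]
        refine Finset.sum_congr rfl fun q _ => ?_
        rw [Function.comp_apply, not_not.1 (hq q)]
    _ ≤ ∑ q : Option (Fin m × Fin 3), (if q = none then 3 else 1) * prob B :=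
        (prob_exists_le _).trans (Finset.sum_le_sum fun q _ => prob_adder_le hm B q)
    _ = (3 * m + 3) * relDist f P := by
        rw [hB, ← Finset.sum_mul, Fintype.sum_option]
        congr 1
        simp
        ring
    _ ≤ (3 * m + 3) * δ := by gcongr

end adder

/-! ### Number of queries -/

theorem clog_two_le (x : ℕ) (hx : 1 ≤ x) : (Nat.clog 2 x : ℝ) ≤ 2 * Real.log x + 1 := by
  rcases hx.eq_or_lt with rfl | hx1
  · simp
  have h1 : (2 : ℝ) ^ (Nat.clog 2 x).pred ≤ x := by
    exact_mod_cast (Nat.pow_pred_clog_lt_self one_lt_two hx1).le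
  have h2 := Real.log_le_log (by positivity) h1
  rw [Real.log_pow] at h2
  have h3 : (Nat.clog 2 x : ℝ) ≤ (Nat.clog 2 x).pred + 1 := by
    exact_mod_cast Nat.le_succ_of_pred_le le_rfl
  have h4 : ((Nat.clog 2 x).pred : ℝ) * (1 / 2) ≤ (Nat.clog 2 x).pred * Real.log 2 := by
    gcongr
    linarith [Real.log_two_gt_d9]
  linarith

/-- The least admissible T works; the exponent 10 comes from 9 ≤ (5/4)^10. -/
theorem exists_rounds (L : ℕ) (hL : 1 ≤ L) :
    ∃ T : ℕ, (L : ℝ) ≤ (5 / 4) ^ T ∧ (9 : ℝ) ^ T ≤ 9 * L ^ 10 := by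
  classical
  have hex : ∃ T : ℕ, (L : ℝ) ≤ (5 / 4) ^ T :=
    (pow_unbounded_of_one_lt (L : ℝ) (by norm_num)).imp fun T h => h.le
  refine ⟨Nat.find hex, Nat.find_spec hex, ?_⟩
  have hL' : (1 : ℝ) ≤ L := by exact_mod_cast hL
  rcases hT : Nat.find hex with _ | T
  · rw [pow_zero]
    have := one_le_pow₀ hL' (n := 10)
    linarith
  · have h1 : (5 / 4 : ℝ) ^ T < L := not_le.1 (Nat.find_min hex (by omega))
    calc (9 : ℝ) ^ (T + 1) = 9 * 9 ^ T := by ring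
      _ ≤ 9 * ((5 / 4) ^ 10) ^ T := by gcongr; norm_num
      _ = 9 * ((5 / 4) ^ T) ^ 10 := by rw [← pow_mul, ← pow_mul, mul_comm 10]
      _ ≤ 9 * L ^ 10 := by gcongr

/-- The number of bits of the adder used for dimension `n`. -/
def adderSize (n : ℕ) : ℕ := Nat.clog 2 n

/-- The number of bits needed for `adderSize n`, up to one. -/
def adderSizeBits (n : ℕ) : ℕ := Nat.clog 2 (adderSize n + 1) + 1

/-- The number of rounds of error reduction used for dimension `n`. -/
noncomputable def reductionRounds (n : ℕ) : ℕ :=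
  (exists_rounds (adderSizeBits n) (Nat.succ_le_succ (Nat.zero_le _))).choose

theorem adderSizeBits_le_pow (n : ℕ) : (adderSizeBits n : ℝ) ≤ (5 / 4) ^ reductionRounds n :=
  (exists_rounds (adderSizeBits n) (Nat.succ_le_succ (Nat.zero_le _))).choose_spec.1

theorem nine_pow_reductionRounds_le (n : ℕ) :
    (9 : ℝ) ^ reductionRounds n ≤ 9 * adderSizeBits n ^ 10 :=
  (exists_rounds (adderSizeBits n) (Nat.succ_le_succ (Nat.zero_le _))).choose_spec.2

/-- After all rounds of error reduction the error is `O(1 / log n)`. -/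
theorem adder_error_le (n : ℕ) :
    (3 * adderSize n + 3) * ((2 : ℝ) ^ (-12 * (5 / 4) ^ reductionRounds n : ℝ)) ^ 4 ≤ 1 / 8 := by
  set m := adderSize n with hm
  set L := adderSizeBits n with hL
  have h1 : ((2 : ℝ) ^ (-12 * (5 / 4) ^ reductionRounds n : ℝ)) ^ 4 ≤ 2 ^ (-(48 * L) : ℝ) := by
    rw [← Real.rpow_mul_natCast (by norm_num)]
    refine Real.rpow_le_rpow_of_exponent_le (by norm_num) ?_
    have := adderSizeBits_le_pow n
    push_cast
    linarith
  have h2 : (m : ℝ) + 1 ≤ 2 ^ L := by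
    have : m + 1 ≤ 2 ^ L :=
      (Nat.le_pow_clog one_lt_two (m + 1)).trans (Nat.pow_le_pow_right two_pos (Nat.le_succ _))
    exact_mod_cast this
  have h3 : (2 : ℝ) ^ (-(48 * L) : ℝ) = ((2 : ℝ) ^ (48 * L))⁻¹ := by
    rw [Real.rpow_neg (by norm_num), ← Real.rpow_natCast]
    push_cast
    rfl
  have hL1 : 1 ≤ L := Nat.succ_le_succ (Nat.zero_le _)
  -- The target 3 (m + 1) ≤ 2^(48 L) / 8 follows from m + 1 ≤ 2^L. The extra 1 in `adderSizeBits`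
  -- ensures L ≥ 1, hence 5 + L ≤ 48 L.
  have h4 : (24 : ℝ) * 2 ^ L ≤ 2 ^ (48 * L) := by
    calc (24 : ℝ) * 2 ^ L ≤ 2 ^ 5 * 2 ^ L := by gcongr; norm_num
      _ = 2 ^ (5 + L) := (pow_add _ _ _).symm
      _ ≤ 2 ^ (48 * L) := by
          gcongr
          · norm_num
          · omega
  rw [h3] at h1
  calc (3 * (m : ℝ) + 3) * ((2 : ℝ) ^ (-12 * (5 / 4) ^ reductionRounds n : ℝ)) ^ 4
      ≤ (3 * (m : ℝ) + 3) * (2 ^ (48 * L))⁻¹ := by gcongr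
    _ ≤ 1 / 8 := by
        rw [← div_eq_mul_inv, div_le_iff₀ (by positivity)]
        linarith

theorem isSoftO_queries (K : ℕ) :
    IsSoftO (fun n => ((K * 9 ^ reductionRounds n * (3 * adderSize n + 1) : ℕ) : ℝ))
      (fun n => Real.log n) := by
  refine ⟨10, IsBigO.of_bound (K * (9 * 6 ^ 10) * 10) ?_⟩
  have hlog : Tendsto (fun n : ℕ => Real.log n) atTop atTop :=
    Real.tendsto_log_atTop.comp tendsto_natCast_atTop_atTop
  -- Once log n ≥ 4, log log n ≥ 1 absorbs the additive constants, and 2 log n + 2 ≤ (log n)^2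
  -- bounds the logarithm of the adder size.
  filter_upwards [hlog.eventually_ge_atTop 4, eventually_ge_atTop 1] with n hn hn1
  set ℓ := Real.log n with hℓ
  have hm : (adderSize n : ℝ) ≤ 2 * ℓ + 1 := clog_two_le n hn1
  have h2 : 1 ≤ Real.log ℓ := by
    have h4 : Real.log 4 ≤ Real.log ℓ := Real.log_le_log (by norm_num) hn
    have : Real.log 4 = 2 * Real.log 2 := by
      rw [show (4 : ℝ) = 2 ^ 2 by norm_num, Real.log_pow]
      norm_num
    linarith [Real.log_two_gt_d9]
  have hL : (adderSizeBits n : ℝ) ≤ 6 * Real.log ℓ := by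
    have h3 := clog_two_le (adderSize n + 1) (Nat.succ_le_succ (Nat.zero_le _))
    have h4 : Real.log ((adderSize n + 1 : ℕ) : ℝ) ≤ 2 * Real.log ℓ := by
      have h5 : Real.log (ℓ ^ 2) = 2 * Real.log ℓ := by
        rw [Real.log_pow]
        norm_num
      rw [← h5]
      refine Real.log_le_log (by positivity) ?_
      push_cast
      nlinarith
    rw [adderSizeBits]
    push_cast
    linarith
  rw [Real.norm_of_nonneg (by positivity), Real.norm_of_nonneg (by positivity)]
  push_cast
  calc (K : ℝ) * 9 ^ reductionRounds n * (3 * adderSize n + 1)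
      ≤ K * (9 * (6 * Real.log ℓ) ^ 10) * (10 * ℓ) := by
        gcongr
        · exact (nine_pow_reductionRounds_le n).trans (by gcongr)
        · linarith
    _ = K * (9 * 6 ^ 10) * 10 * (ℓ * Real.log ℓ ^ 10) := by ring

/-! ### Assembling the three correctors -/

theorem theorem1p1 (ε : ℝ) (hε : 0 < ε) :
    ∃ q : ℕ → ℕ, IsSoftO (fun n => (q n : ℝ)) (fun n => Real.log n) ∧
      ∀ (G : Type*) [AddCommGroup G] (n : ℕ),
        HasLocalCorrection (polyDegLE n G 1) (1 / 4 - ε) (q n) := by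
  set δ₀ : ℝ := ((2 : ℝ) ^ (-12 : ℝ)) ^ 4 with hδ₀
  have hδ₀_pos : 0 < δ₀ := by positivity
  -- With this k the subcube stage fails with probability at most 1/16; k depends on ε alone, not on
  -- n or G.
  obtain ⟨k, hk⟩ := exists_nat_ge (1 / (1 / 16 * δ₀ * ε ^ 2))
  have hk' : 1 ≤ 1 / 16 * δ₀ * ε ^ 2 * k := by
    rwa [div_le_iff₀ (by positivity), mul_comm] at hk
  have : NeZero k := ⟨by rintro rfl; norm_num at hk'⟩
  refine ⟨fun n => 2 ^ k * 9 ^ reductionRounds n * (3 * adderSize n + 1), isSoftO_queries (2 ^ k),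
    fun G _ n => ?_⟩
  have h1 : HasReduction (polyDegLE n G 1) (1 / 4 - ε) δ₀ (1 / 16) (2 ^ k) :=
    hasReduction_subcube hε hδ₀_pos hk'
  have h2 : ((1 : ℝ) - (1 / 8) ^ reductionRounds n) / 64 ≤ 1 / 64 := by
    have : (0 : ℝ) < (1 / 8) ^ reductionRounds n := by positivity
    linarith
  have h3 := h1.trans ((hasReduction_iterate (reductionRounds n)).mono le_rfl h2) (by norm_num)
  have h4 := h3.hasCorrection (hasCorrection_adder (Nat.le_pow_clog one_lt_two n) _)
    (by positivity)
  -- The failure budget is 1/16 + 1/64 + 1/8 < 1/4.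
  refine h4.hasLocalCorrection ?_
  have := adder_error_le n
  rw [adderSize] at this
  linarith
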